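/- Let $p$ be a prime number and let $O$ be a Noetherian integral domain of characteristic $0$. All group schemes are commutative. Let $\mathscr{C}$ be a full subcategory of the category of finite flat commutative group schemes of $p$-power order over $O$ that is closed under taking (binary) products, closed flat subgroup schemes, and quotients by closed flat subgroup schemes. For group schemes $A,B$ in $\mathscr{C}$ let $\operatorname{Ext}^1_{\mathscr{C}}(A,B)$ be the group of equivalence classes of extensions $0\to B\to E\to A\to 0$ with $E$ in $\mathscr{C}$. Let $\{G_i\}_{i\in I}$ be a finite family of $p$-divisible groups over $O$ such that, for each $i\in I$: - the endomorphism ring $R_i=\operatorname{End}(G_i)$ is a discrete valuation ring, with uniformizer $\pi_i$ and residue field $k_i=R_i/\pi_iR_i$; - for every $n$ the group scheme $G_i[\pi_i^n]=\ker(\pi_i^n\colon G_i\to G_i)$ is an object of $\mathscr{C}$; - the connecting map $$\delta\colon \operatorname{Hom}_O(G_i[\pi_i],G_i[\pi_i])\longrightarrow \operatorname{Ext}^1_{\mathscr{C}}(G_i[\pi_i],G_i[\pi_i])$$ associated to the exact sequence $0\to G_i[\pi_i]\to G_i[\pi_i^2]\xrightarrow{\ \pi_i\ }G_i[\pi_i]\to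 0$, which sends $f$ to the class of the pullback of this sequence along $f$, is an isomorphism of $1$-dimensional $k_i$-vector spaces; - for each $j\in I$ with $j\neq i$, the groups $\operatorname{Ext}^1_{\mathscr{C}}(G_i[\pi_i],G_j[\pi_j])$ and $\operatorname{Ext}^1_{\mathscr{C}}(G_j[\pi_j],G_i[\pi_i])$ are trivial. Let $X$ be an object of $\mathscr{C}$ that admits a filtration $0=X_0\subset X_1\subset\dots\subset X_m=X$ by closed flat subgroup schemes such that each successive quotient $X_{t}/X_{t-1}$ is isomorphic to $G_i[\pi_i]$ for some $i\in I$. Then there are an integer $r\ge 0$, indices $i_1,\dots,i_r\in I$ and integers $n_1,\dots,n_r\ge 1$ such that $$X\;\cong\;\bigoplus_{s=1}^{r} G_{i_s}[\pi_{i_s}^{\,n_s}].$$ -/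

import Mathlib

open CategoryTheory Limits AlgebraicGeometry MonoidalCategory CartesianMonoidalCategory

universe u v w

noncomputable section

/-! ### Commutative group objects form an additive category with limits -/

namespace CategoryTheory.CommGrp

open scoped CategoryTheory.MonObj

variable {C : Type u} [Category.{v} C] [CartesianMonoidalCategory C] [BraidedCategory C]

instance homAdd (A B : CommGrp C) : Add (A ⟶ B) :=
  ⟨fun f g => InducedCategory.homMk (f.hom * g.hom)⟩

instance homZero (A B : CommGrp C) : Zero (A ⟶ B) := ⟨InducedCategory.homMk 1⟩

instance homNeg (A B : CommGrp C) : Neg (A ⟶ B) := ⟨fun f => InducedCategory.homMk f.hom⁻¹⟩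

/-- Homomorphisms into a commutative group object are added pointwise, through the group law of
the target (which Mathlib writes multiplicatively). -/
instance homAddCommGroup (A B : CommGrp C) : AddCommGroup (A ⟶ B) where
  nsmul := nsmulRec
  zsmul := zsmulRec
  add_assoc f g h := InducedCategory.hom_ext (mul_assoc f.hom g.hom h.hom)
  zero_add f := InducedCategory.hom_ext (one_mul f.hom)
  add_zero f := InducedCategory.hom_ext (mul_one f.hom)
  neg_add_cancel f := InducedCategory.hom_ext (inv_mul_cancel f.hom)
  add_comm f g := InducedCategory.hom_ext (mul_comm f.hom g.hom)

theorem hom_add {A B : CommGrp C} (f g : A ⟶ B) :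
    (f + g).hom.hom.hom = f.hom.hom.hom * g.hom.hom.hom := rfl

instance preadditive : Preadditive (CommGrp C) where
  add_comp A B D f g h := by
    apply CommGrp.hom_ext
    simp [hom_add, MonObj.mul_comp]
  comp_add A B D f g h := by
    apply CommGrp.hom_ext
    simp [hom_add, MonObj.comp_mul]

section Limits

variable {J : Type w} [Category J] [HasLimitsOfShape J C]

/-- A limit of commutative group objects is commutative. -/
theorem isCommMonObj_limit (F : J ⥤ CommGrp C) :
    IsCommMonObj (limit (F ⋙ forget₂Grp C)).X := by
  rw [isCommMonObj_iff_isMulCommutative]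
  refine fun X => ⟨⟨fun f g => ?_⟩⟩
  have hl := isLimitOfPreserves (Grp.forget C) (limit.isLimit (F ⋙ forget₂Grp C))
  refine hl.hom_ext fun j => ?_
  have hc : IsCommMonObj ((F ⋙ forget₂Grp C).obj j).X := (F.obj j).comm
  change (f * g) ≫ (limit.π (F ⋙ forget₂Grp C) j).hom.hom =
    (g * f) ≫ (limit.π (F ⋙ forget₂Grp C) j).hom.hom
  rw [MonObj.mul_comp, MonObj.mul_comp, mul_comm]

instance hasLimitsOfShape : HasLimitsOfShape J (CommGrp C) where
  has_limit F := by
    let L : CommGrp C :=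
      { X := (limit (F ⋙ forget₂Grp C)).X
        comm := isCommMonObj_limit F }
    have : CreatesLimit F (forget₂Grp C) :=
      createsLimitOfFullyFaithfulOfIso L (Iso.refl _)
    exact hasLimit_of_created F (forget₂Grp C)

end Limits

end CategoryTheory.CommGrp

/-! ### Finite flat commutative group schemes over a ring -/

/-- Commutative group schemes over `Spec O`, with homomorphisms of group schemes over `O`. -/
abbrev CommGroupScheme (O : Type u) [CommRing O] : Type (u + 1) :=
  CommGrp (Over (Spec (CommRingCat.of O)))

namespace CommGroupScheme

variable {O : Type u} [CommRing O]

instance hasFiniteLimits : HasFiniteLimits (CommGroupScheme O) where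
  out _ _ _ := inferInstance

instance hasFiniteBiproducts : HasFiniteBiproducts (CommGroupScheme O) :=
  HasFiniteBiproducts.of_hasFiniteProducts

/-- The structure morphism `X ⟶ Spec O` of a group scheme. -/
abbrev structureMap (X : CommGroupScheme O) : X.X.left ⟶ Spec (CommRingCat.of O) := X.X.hom

/-- The morphism of schemes underlying a homomorphism of group schemes. -/
abbrev schemeMap {X Y : CommGroupScheme O} (f : X ⟶ Y) : X.X.left ⟶ Y.X.left := f.hom.hom.hom.left

/-- `X` is finite and flat over `O`. -/
structure IsFiniteFlat (X : CommGroupScheme O) : Prop where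
  finite : IsFinite X.structureMap
  flat : Flat X.structureMap

/-- `X` has order `m`: its structure morphism has constant rank `m`. -/
def HasOrder (X : CommGroupScheme O) (m : ℕ) : Prop :=
  ∀ s, X.structureMap.finrank s = m

/-- `i : X ⟶ Y` exhibits `X` as a closed flat subgroup scheme of `Y`. -/
structure IsClosedFlatSubgroup {X Y : CommGroupScheme O} (i : X ⟶ Y) : Prop where
  closed : IsClosedImmersion (schemeMap i)
  flat : Flat X.structureMap

/-- `0 ⟶ A ⟶ B ⟶ D ⟶ 0` is exact, for finite flat group schemes: `i` is a kernel of `q` and `q` is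
faithfully flat. In other words, `q` exhibits `D` as the quotient of `B` by `A`. -/
structure IsShortExact {A B D : CommGroupScheme O} (i : A ⟶ B) (q : B ⟶ D) : Prop where
  comp_eq_zero : i ≫ q = 0
  isKernel : Nonempty (IsLimit (KernelFork.ofι i comp_eq_zero))
  flat : Flat (schemeMap q)
  surjective : Surjective (schemeMap q)

/-- `X` has a filtration `0 = X₀ ⊆ X₁ ⊆ ⋯ ⊆ Xₘ = X` by closed flat subgroup schemes, all of whose
successive quotients satisfy `S`. The filtration is built from the bottom, each step being
`0 ⟶ Xₖ ⟶ Xₖ₊₁ ⟶ Q ⟶ 0` with `Q` in `S`. -/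
inductive HasFiltration (S : ObjectProperty (CommGroupScheme O)) : CommGroupScheme O → Prop
  | zero (X : CommGroupScheme O) (hX : IsZero X) : HasFiltration S X
  | step {A B Q : CommGroupScheme O} (i : A ⟶ B) (q : B ⟶ Q) (hA : HasFiltration S A)
      (hi : IsClosedFlatSubgroup i) (hB : IsFiniteFlat B) (h : IsShortExact i q) (hQ : S Q) :
      HasFiltration S B

/-! ### Extensions inside a full subcategory -/

/-- An extension `0 ⟶ B ⟶ E ⟶ A ⟶ 0` of `A` by `B` whose middle term lies in `𝒞`. -/
structure Extension (𝒞 : ObjectProperty (CommGroupScheme O)) (A B : CommGroupScheme O) where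
  mid : CommGroupScheme O
  mem : 𝒞 mid
  inc : B ⟶ mid
  proj : mid ⟶ A
  exact : IsShortExact inc proj

/-- Two extensions are equivalent if an isomorphism of the middle terms induces the identity on
the sub and on the quotient. -/
instance Extension.setoid (𝒞 : ObjectProperty (CommGroupScheme O)) (A B : CommGroupScheme O) :
    Setoid (Extension 𝒞 A B) where
  r E E' := ∃ φ : E.mid ≅ E'.mid, E.inc ≫ φ.hom = E'.inc ∧ φ.hom ≫ E'.proj = E.proj
  iseqv :=
    { refl := fun E => ⟨Iso.refl _, by simp, by simp⟩
      symm := by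
        rintro E E' ⟨φ, h₁, h₂⟩
        exact ⟨φ.symm, by simp [← h₁], by simp [← h₂]⟩
      trans := by
        rintro E E' E'' ⟨φ, h₁, h₂⟩ ⟨ψ, h₃, h₄⟩
        exact ⟨φ ≪≫ ψ, by simp [← h₃, ← h₁], by simp [← h₂, ← h₄]⟩ }

/-- `Ext_𝒞(A, B)`: equivalence classes of extensions of `A` by `B` whose middle term lies in `𝒞`.
Its zero element is the class of the split extension. -/
def ExtIn (𝒞 : ObjectProperty (CommGroupScheme O)) (A B : CommGroupScheme O) : Type (u + 1) :=
  Quotient (Extension.setoid 𝒞 A B)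

end CommGroupScheme

open CommGroupScheme

/-! ### `p`-divisible groups -/

/-- A `p`-divisible group over `O`: an inductive system of finite flat commutative group schemes
`Gₙ` of order `p ^ (n * h)` such that `Gₙ ⟶ Gₙ₊₁` is a kernel of multiplication by `p ^ n`. -/
structure PDivisibleGroup (p : ℕ) (O : Type u) [CommRing O] where
  height : ℕ
  level : ℕ → CommGroupScheme O
  isFiniteFlat (n : ℕ) : IsFiniteFlat (level n)
  hasOrder (n : ℕ) : HasOrder (level n) (p ^ (n * height))
  incl (n : ℕ) : level n ⟶ level (n + 1)
  incl_pow (n : ℕ) : incl n ≫ ((p ^ n : ℕ) • 𝟙 (level (n + 1))) = 0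
  isKernel (n : ℕ) : Nonempty (IsLimit (KernelFork.ofι (incl n) (incl_pow n)))

namespace PDivisibleGroup

variable {p : ℕ} {O : Type u} [CommRing O]

/-- A homomorphism of `p`-divisible groups: a homomorphism on each level, compatible with the
inclusions. -/
@[ext]
structure Hom (G H : PDivisibleGroup p O) where
  app (n : ℕ) : G.level n ⟶ H.level n
  comm (n : ℕ) : G.incl n ≫ app (n + 1) = app n ≫ H.incl n

instance category : Category (PDivisibleGroup p O) where
  Hom G H := Hom G H
  id G := ⟨fun _ => 𝟙 _, fun _ => by simp⟩
  comp f g := ⟨fun n => f.app n ≫ g.app n, fun n => by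
    rw [← Category.assoc, f.comm, Category.assoc, g.comm, Category.assoc]⟩
  id_comp f := Hom.ext (funext fun n => Category.id_comp (f.app n))
  comp_id f := Hom.ext (funext fun n => Category.comp_id (f.app n))
  assoc f g h := Hom.ext (funext fun n => Category.assoc (f.app n) (g.app n) (h.app n))

/-- The component of a homomorphism at level `n`. -/
def app {G H : PDivisibleGroup p O} (f : G ⟶ H) (n : ℕ) : G.level n ⟶ H.level n := Hom.app f n

variable {G H K : PDivisibleGroup p O}

@[ext]
theorem hom_ext {f g : G ⟶ H} (h : ∀ n, app f n = app g n) : f = g := Hom.ext (funext h)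

theorem incl_app (f : G ⟶ H) (n : ℕ) : G.incl n ≫ app f (n + 1) = app f n ≫ H.incl n :=
  Hom.comm f n

instance homAdd : Add (G ⟶ H) := ⟨fun f g => ⟨fun n => app f n + app g n, fun n => by
  simp [incl_app]⟩⟩

instance homZero : Zero (G ⟶ H) := ⟨⟨fun _ => 0, fun n => by simp⟩⟩

instance homNeg : Neg (G ⟶ H) := ⟨fun f => ⟨fun n => -app f n, fun n => by simp [incl_app]⟩⟩

@[simp] theorem id_app (n : ℕ) : app (𝟙 G) n = 𝟙 (G.level n) := rfl

@[simp] theorem comp_app (f : G ⟶ H) (g : H ⟶ K) (n : ℕ) :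
    app (f ≫ g) n = app f n ≫ app g n := rfl

@[simp] theorem add_app (f g : G ⟶ H) (n : ℕ) : app (f + g) n = app f n + app g n := rfl

@[simp] theorem zero_app (n : ℕ) : app (0 : G ⟶ H) n = 0 := rfl

@[simp] theorem neg_app (f : G ⟶ H) (n : ℕ) : app (-f) n = -app f n := rfl

/-- Homomorphisms of `p`-divisible groups are added levelwise. -/
instance homAddCommGroup : AddCommGroup (G ⟶ H) where
  nsmul := nsmulRec
  zsmul := zsmulRec
  add_assoc f g h := by ext n; simp [add_assoc]
  zero_add f := by ext n; simp
  add_zero f := by ext n; simp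
  neg_add_cancel f := by ext n; simp
  add_comm f g := by ext n; simp [add_comm]

/-- In particular `End G` is a ring, with composition as multiplication. -/
instance preadditive : Preadditive (PDivisibleGroup p O) where
  add_comp _ _ _ f g h := by ext n; simp
  comp_add _ _ _ f g h := by ext n; simp

/-- For an endomorphism `f` of `G`, the group scheme `G[fⁿ]`, realised as the kernel of `fⁿ` on
`Gₙ = G[pⁿ]`. This is all of the kernel of `fⁿ` on `G` as soon as `f` divides `p` in a commutative
subring of `End G`, as a uniformizer does when `End G` is a discrete valuation ring. -/
def torsion (G : PDivisibleGroup p O) (f : End G) (n : ℕ) : CommGroupScheme O :=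
  kernel (app (f ^ n : End G) n)

/-- The inclusion `G[fⁿ] ⟶ Gₙ`. -/
def torsionIncl (G : PDivisibleGroup p O) (f : End G) (n : ℕ) : G.torsion f n ⟶ G.level n :=
  kernel.ι (app (f ^ n : End G) n)

theorem torsionIncl_comp (G : PDivisibleGroup p O) (f : End G) (n : ℕ) :
    G.torsionIncl f n ≫ app (f ^ n : End G) n = 0 :=
  kernel.condition _

instance torsionIncl_mono (G : PDivisibleGroup p O) (f : End G) (n : ℕ) :
    Mono (G.torsionIncl f n) :=
  inferInstanceAs (Mono (kernel.ι (app (f ^ n : End G) n)))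

/-- The inclusion `G[fⁿ] ⟶ G[fⁿ⁺¹]`, induced by `Gₙ ⟶ Gₙ₊₁`. -/
def torsionSucc (G : PDivisibleGroup p O) (f : End G) (n : ℕ) :
    G.torsion f n ⟶ G.torsion f (n + 1) :=
  kernel.lift _ (G.torsionIncl f n ≫ G.incl n) (by
    rw [Category.assoc, incl_app, pow_succ', End.mul_def, comp_app, ← Category.assoc,
      ← Category.assoc, torsionIncl_comp, zero_comp, zero_comp])

section Residue

variable {R : Type w} [CommRing R] (e : R ≃+* End G) (ϖ : R)

theorem torsionAction_aux (n : ℕ) (r : R) :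
    app (e ϖ ^ n : End G) n ≫ app (e r) n = app (e r) n ≫ app (e ϖ ^ n : End G) n := by
  have h : e r * e ϖ ^ n = e ϖ ^ n * e r := by rw [← map_pow, ← map_mul, ← map_mul, mul_comm]
  exact congrArg (fun f : G ⟶ G => app f n) h

/-- When `End G` is identified with a commutative ring `R`, an element of `R` acts on `G[ϖⁿ]` by
restriction of the corresponding endomorphism of `G`. -/
def torsionMap (n : ℕ) (r : R) : G.torsion (e ϖ) n ⟶ G.torsion (e ϖ) n :=
  kernel.map _ _ (app (e r) n) (app (e r) n) (torsionAction_aux e ϖ n r)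

theorem torsionMap_incl (n : ℕ) (r : R) :
    torsionMap e ϖ n r ≫ G.torsionIncl (e ϖ) n = G.torsionIncl (e ϖ) n ≫ app (e r) n :=
  kernel.lift_ι _ _ _

/-- The action of `R` on `G[ϖⁿ]` as a ring homomorphism. -/
def torsionAction (n : ℕ) : R →+* End (G.torsion (e ϖ) n) where
  toFun r := torsionMap e ϖ n r
  map_one' := by
    rw [← cancel_mono (G.torsionIncl (e ϖ) n), torsionMap_incl, map_one]
    simp [End.one_def]
  map_mul' r s := by
    rw [← cancel_mono (G.torsionIncl (e ϖ) n), torsionMap_incl, map_mul, End.mul_def, End.mul_def,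
      Category.assoc, torsionMap_incl, ← Category.assoc, torsionMap_incl, comp_app, Category.assoc]
  map_zero' := by
    rw [← cancel_mono (G.torsionIncl (e ϖ) n), torsionMap_incl, map_zero, zero_app, comp_zero,
      zero_comp]
  map_add' r s := by
    rw [← cancel_mono (G.torsionIncl (e ϖ) n), torsionMap_incl, map_add, add_app,
      Preadditive.comp_add, Preadditive.add_comp, torsionMap_incl, torsionMap_incl]

/-- The action of the residue field `k = R / ϖ R` on `G[ϖ]`. -/
def residueAction : R ⧸ Ideal.span {ϖ} →+* End (G.torsion (e ϖ) 1) :=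
  Ideal.Quotient.lift _ (torsionAction e ϖ 1) (by
    intro a ha
    obtain ⟨b, rfl⟩ := Ideal.mem_span_singleton'.1 ha
    have h : torsionMap e ϖ 1 ϖ = 0 := by
      rw [← cancel_mono (G.torsionIncl (e ϖ) 1), torsionMap_incl, zero_comp]
      simpa using torsionIncl_comp G (e ϖ) 1
    rw [map_mul]
    have h' : torsionAction e ϖ 1 ϖ = 0 := h
    rw [h', mul_zero])

/-- The dimension of `Hom(G[ϖ], G[ϖ])` as a vector space over `k = R / ϖ R`, which acts through
its action on the target. -/
def homFinrank : ℕ :=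
  letI : Module (R ⧸ Ideal.span {ϖ}) (G.torsion (e ϖ) 1 ⟶ G.torsion (e ϖ) 1) :=
    Module.compHom _ (residueAction e ϖ)
  Module.finrank (R ⧸ Ideal.span {ϖ}) (G.torsion (e ϖ) 1 ⟶ G.torsion (e ϖ) 1)

end Residue

/-- The graph of the connecting map `δ : Hom(G[ϖ], G[ϖ]) ⟶ Ext_𝒞(G[ϖ], G[ϖ])` attached to the exact
sequence `0 ⟶ G[ϖ] ⟶ G[ϖ²] ⟶ G[ϖ] ⟶ 0` whose second map is multiplication by `ϖ`: the class `c` is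
`δ f` when it is the class of the pullback of that sequence along `f`, that is, of an extension `E`
with a commutative diagram

    0 ⟶ G[ϖ] ⟶  E   ⟶ G[ϖ] ⟶ 0
         ‖       |h       |f
    0 ⟶ G[ϖ] ⟶ G[ϖ²] ⟶ G[ϖ] ⟶ 0.

The right-hand square is written out after the inclusion of the lower right `G[ϖ]` into `G₂`. -/
def IsConnecting (G : PDivisibleGroup p O) (ϖ : End G) (𝒞 : ObjectProperty (CommGroupScheme O))
    (f : G.torsion ϖ 1 ⟶ G.torsion ϖ 1) (c : ExtIn 𝒞 (G.torsion ϖ 1) (G.torsion ϖ 1)) : Prop :=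
  ∃ (E : Extension 𝒞 (G.torsion ϖ 1) (G.torsion ϖ 1)) (h : E.mid ⟶ G.torsion ϖ 2),
    Quotient.mk _ E = c ∧ E.inc ≫ h = G.torsionSucc ϖ 1 ∧
      h ≫ G.torsionIncl ϖ 2 ≫ app ϖ 2 = E.proj ≫ f ≫ G.torsionIncl ϖ 1 ≫ G.incl 1

end PDivisibleGroup
end

open CommGroupScheme

/-!
The group schemes `G[πⁿ]` form a tower with exact sequences `0 ⟶ G[π] ⟶ G[πⁿ⁺¹] ⟶ G[πⁿ] ⟶ 0` and
`0 ⟶ G[πⁿ] ⟶ G[πⁿ⁺¹] ⟶ G[π] ⟶ 0`. The point is that multiplication by `π` is faithfully flat from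
`G[πⁿ⁺¹]` to `G[πⁿ]`. A homomorphism `A ⟶ B` with finite flat kernel `K` is faithfully flat as soon
as it is injective on functions, because `A ×_B A ≅ A × K` has constant rank over `A`, which forces
`A` to be flat over `B`. Multiplication by `p` on the levels is injective on functions, since over
the domain `O` the orders of kernel and target multiply to that of the source, and multiplication by
`π` inherits this from multiplication by `p`, of which it is a factor.

The decomposition is by induction along the filtration. Let `0 ⟶ X' ⟶ X ⟶ G_j[π_j] ⟶ 0` be exact,
with `X'` the direct sum of terms `T_s = G_i[π_i^n]`, where `i` and `n` depend on `s`. By the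
hypotheses on `Ext`, every projection `X' ⟶ T_s` extends to a map from `X` to the next term of the
tower of `T_s`. The obstruction to staying in `T_s` is a map `g_s` from `G_j[π_j]` to `G_i[π_i]`,
which is zero unless `i = j`. Since `Hom(G_j[π_j], G_j[π_j])` is one-dimensional, a change of
coordinates by endomorphisms of the tower makes all obstructions vanish except one, which belongs to
a summand with `g_s ≠ 0` and `n` maximal. Then `X` is obtained from `X'` by raising this `n` to
`n + 1`. If all `g_s` vanish, the argument applies after adding the zero summand `G_j[π_j^0]`.
-/

/-! ### Descent of flatness along injective integral ring maps -/

section Rank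

open scoped TensorProduct

variable {C M N : Type*} [CommRing C] [CommRing M] [Algebra C M] [AddCommGroup N] [Module C N]

theorem isLocalHom_algebraMap_residueField [IsLocalRing C] (P : PrimeSpectrum M)
    (hP : P.comap (algebraMap C M) = IsLocalRing.closedPoint C) :
    IsLocalHom (algebraMap C P.asIdeal.ResidueField) where
  map_nonunit a ha := by
    by_contra h
    have haP : a ∈ (P.comap (algebraMap C M)).asIdeal :=
      hP ▸ (IsLocalRing.mem_maximalIdeal a).2 h
    refine ha.ne_zero ?_
    rw [IsScalarTower.algebraMap_apply C M]
    exact Ideal.algebraMap_residueField_eq_zero.2 haP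

theorem finrank_residueField_tensor_of_rankAtStalk_baseChange [IsLocalRing C] [Module.Finite C N]
    [Module.Flat M (M ⊗[C] N)] (P : PrimeSpectrum M)
    (hP : P.comap (algebraMap C M) = IsLocalRing.closedPoint C) :
    Module.finrank (IsLocalRing.ResidueField C) (IsLocalRing.ResidueField C ⊗[C] N) =
      Module.rankAtStalk (M ⊗[C] N) P := by
  let k := IsLocalRing.ResidueField C
  let K := P.asIdeal.ResidueField
  have := isLocalHom_algebraMap_residueField P hP
  let : Algebra k K := (IsLocalRing.ResidueField.lift (algebraMap C K)).toAlgebra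
  have : IsScalarTower C k K := IsScalarTower.of_algebraMap_eq fun a =>
    (IsLocalRing.ResidueField.lift_residue_apply (algebraMap C K) a).symm
  let eM : K ⊗[M] (M ⊗[C] N) ≃ₗ[K] K ⊗[C] N :=
    TensorProduct.AlgebraTensorModule.cancelBaseChange C M K K N
  let ek : K ⊗[k] (k ⊗[C] N) ≃ₗ[K] K ⊗[C] N :=
    TensorProduct.AlgebraTensorModule.cancelBaseChange C k K K N
  calc Module.finrank k (k ⊗[C] N)
      = Module.finrank K (K ⊗[k] (k ⊗[C] N)) := Module.finrank_baseChange.symm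
    _ = Module.finrank K (K ⊗[M] (M ⊗[C] N)) := (ek ≪≫ₗ eM.symm).finrank_eq
    _ = Module.rankAtStalk (M ⊗[C] N) P := (Module.rankAtStalk_eq P).symm

theorem exists_surjective_finrank_residueField [IsLocalRing C] [Module.Finite C N] :
    ∃ g : (Fin (Module.finrank (IsLocalRing.ResidueField C)
      (IsLocalRing.ResidueField C ⊗[C] N)) → C) →ₗ[C] N, Function.Surjective g := by
  let k := IsLocalRing.ResidueField C
  let b := Module.finBasis k (k ⊗[C] N)
  choose f hf using fun i =>
    TensorProduct.mk_surjective C N k IsLocalRing.residue_surjective (b i)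
  refine ⟨Fintype.linearCombination C f, ?_⟩
  rw [← LinearMap.range_eq_top, Fintype.range_linearCombination]
  exact IsLocalRing.span_eq_top_of_tmul_eq_basis f b hf

theorem injective_of_injective_baseChange {F : Type*} [AddCommGroup F] [Module C F]
    [Module.Flat C F] (hinj : Function.Injective (algebraMap C M)) {g : F →ₗ[C] N}
    (hg : Function.Injective (g.baseChange M)) : Function.Injective g := by
  have hF : Function.Injective (TensorProduct.mk C M F 1) := by
    have h := (Module.Flat.rTensor_preserves_injective_linearMap (M := F)
      (Algebra.linearMap C M) hinj).comp (TensorProduct.lid C F).symm.injective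
    convert h
    ext
    simp
  intro x y hxy
  refine hF (hg ?_)
  simp [hxy]

theorem flat_of_rankAtStalk_baseChange_of_isLocalRing [IsLocalRing C] [Algebra.IsIntegral C M]
    [Module.Finite C N] (hinj : Function.Injective (algebraMap C M)) [Module.Flat M (M ⊗[C] N)]
    (d : ℕ) (hd : ∀ P, Module.rankAtStalk (R := M) (M ⊗[C] N) P = d) : Module.Flat C N := by
  have : FaithfulSMul C M := (faithfulSMul_iff_algebraMap_injective C M).2 hinj
  have : Nontrivial M := hinj.nontrivial
  obtain ⟨P, hP⟩ := Algebra.IsIntegral.comap_surjective C M (IsLocalRing.closedPoint C)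
  have hn := finrank_residueField_tensor_of_rankAtStalk_baseChange (N := N) P hP
  rw [hd] at hn
  obtain ⟨g, hg⟩ := exists_surjective_finrank_residueField (C := C) (N := N)
  have hgM : Function.Bijective (g.baseChange M) :=
    Module.bijective_of_surjective_of_rankAtStalk_eq (LinearMap.lTensor_surjective M hg)
      fun m _ => by
        rw [hd, Module.rankAtStalk_eq_finrank_of_free]
        simp [hn]
  have hginj := injective_of_injective_baseChange hinj hgM.injective
  exact Module.Flat.of_linearEquiv (LinearEquiv.ofBijective g ⟨hginj, hg⟩).symm

-- Over `L ⊗[C] M`, the base change of `N` can be computed through `L` or through `M`.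
theorem flat_localization_of_rankAtStalk_baseChange {L : Type*} [CommRing L] [Algebra C L]
    [IsLocalRing L] [Module.Flat C L] [Algebra.IsIntegral C M] [Module.Finite C N]
    (hinj : Function.Injective (algebraMap C M)) [Module.Flat M (M ⊗[C] N)] (d : ℕ)
    (hd : ∀ P, Module.rankAtStalk (R := M) (M ⊗[C] N) P = d) : Module.Flat L (L ⊗[C] N) := by
  let : Algebra M (L ⊗[C] M) := Algebra.TensorProduct.rightAlgebra
  have : IsScalarTower C M (L ⊗[C] M) := Algebra.TensorProduct.right_isScalarTower
  let e : (L ⊗[C] M) ⊗[M] (M ⊗[C] N) ≃ₗ[L ⊗[C] M] (L ⊗[C] M) ⊗[L] (L ⊗[C] N) :=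
    TensorProduct.AlgebraTensorModule.cancelBaseChange C M (L ⊗[C] M) (L ⊗[C] M) N ≪≫ₗ
      (TensorProduct.AlgebraTensorModule.cancelBaseChange C L (L ⊗[C] M) (L ⊗[C] M) N).symm
  have : Module.Flat (L ⊗[C] M) ((L ⊗[C] M) ⊗[L] (L ⊗[C] N)) := Module.Flat.of_linearEquiv e.symm
  refine flat_of_rankAtStalk_baseChange_of_isLocalRing (M := L ⊗[C] M)
    (Algebra.TensorProduct.includeLeft_injective (S := L) hinj) d fun Q => ?_
  rw [← Module.rankAtStalk_eq_of_equiv e, Module.rankAtStalk_baseChange, hd]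

theorem flat_of_rankAtStalk_baseChange [Algebra.IsIntegral C M] [Module.Finite C N]
    (hinj : Function.Injective (algebraMap C M)) [Module.Flat M (M ⊗[C] N)] (d : ℕ)
    (hd : ∀ P, Module.rankAtStalk (R := M) (M ⊗[C] N) P = d) : Module.Flat C N := by
  refine Module.flat_of_isLocalized_maximal C N (fun P _ => Localization.AtPrime P ⊗[C] N)
    (fun P _ => TensorProduct.mk C (Localization.AtPrime P) N 1) fun P _ => ?_
  rw [← Module.flat_iff_of_isLocalization (Localization.AtPrime P) P.primeCompl]
  have : Module.Flat C (Localization.AtPrime P) := IsLocalization.flat _ P.primeCompl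
  exact flat_localization_of_rankAtStalk_baseChange hinj d hd

theorem rankAtStalk_eq_of_rankAtStalk_baseChange [Algebra.IsIntegral C M] [Module.Finite C N]
    [Module.Flat C N] (hinj : Function.Injective (algebraMap C M)) (d : ℕ)
    (hd : ∀ P, Module.rankAtStalk (R := M) (M ⊗[C] N) P = d) (P : PrimeSpectrum C) :
    Module.rankAtStalk N P = d := by
  have : FaithfulSMul C M := (faithfulSMul_iff_algebraMap_injective C M).2 hinj
  obtain ⟨Q, rfl⟩ := Algebra.IsIntegral.comap_surjective C M P
  rw [← hd Q, Module.rankAtStalk_baseChange]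

end Rank

section Degree

open scoped TensorProduct

theorem nonempty_basis_of_rankAtStalk_eq {C M : Type*} [CommRing C] [Finite (MaximalSpectrum C)]
    [AddCommGroup M] [Module C M] [Module.Finite C M] [Module.Flat C M] (d : ℕ)
    (hd : ∀ P, Module.rankAtStalk (R := C) M P = d) : Nonempty (Module.Basis (Fin d) C M) := by
  refine Module.nonempty_basis_of_flat_of_finrank_eq C M d fun P => ?_
  let := Ideal.Quotient.field P.asIdeal
  let Q : PrimeSpectrum (C ⧸ P.asIdeal) := ⟨⊥, Ideal.isPrime_bot⟩
  rw [← hd (Q.comap (algebraMap C (C ⧸ P.asIdeal))), ← Module.rankAtStalk_baseChange,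
    Module.rankAtStalk_eq_finrank_of_free]
  rfl

theorem finrank_fractionRing_tensor (O : Type*) [CommRing O] [IsDomain O] (N : Type*)
    [AddCommGroup N] [Module O N] :
    Module.finrank (FractionRing O) (FractionRing O ⊗[O] N) = Module.finrank O N := by
  rw [← IsLocalizedModule.finrank_eq (nonZeroDivisors O)
    (TensorProduct.mk O (FractionRing O) N 1) le_rfl]
  exact IsLocalization.finrank_eq _ (nonZeroDivisors O) le_rfl

variable {O C M : Type*} [CommRing O] [IsDomain O] [CommRing C] [Algebra O C] [Module.Finite O C]

theorem finrank_eq_mul_of_rankAtStalk_eq [AddCommGroup M] [Module O M] [Module C M]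
    [IsScalarTower O C M] [Module.Finite C M] [Module.Flat C M] (d : ℕ)
    (hd : ∀ P, Module.rankAtStalk (R := C) M P = d) :
    Module.finrank O M = d * Module.finrank O C := by
  let K := FractionRing O
  let C' := K ⊗[O] C
  let : Algebra C C' := Algebra.TensorProduct.rightAlgebra
  have : IsScalarTower O C C' := Algebra.TensorProduct.right_isScalarTower
  have : IsArtinianRing C' := IsArtinianRing.of_finite K C'
  obtain ⟨b⟩ := nonempty_basis_of_rankAtStalk_eq (C := C') (M := C' ⊗[C] M) d fun P => by
    rw [Module.rankAtStalk_baseChange, hd]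
  let e : C' ⊗[C] M ≃ₗ[K] K ⊗[O] M := Algebra.IsPushout.cancelBaseChange O K C C' M
  calc Module.finrank O M
      = Module.finrank K (K ⊗[O] M) := (finrank_fractionRing_tensor O M).symm
    _ = Module.finrank K (Fin d → C') :=
      (e.symm ≪≫ₗ b.equivFun.restrictScalars K).finrank_eq
    _ = d * Module.finrank K C' := by
      rw [Module.finrank_pi_fintype]
      simp only [Finset.sum_const, Finset.card_univ, Fintype.card_fin, smul_eq_mul]
    _ = d * Module.finrank O C := by rw [finrank_fractionRing_tensor]

theorem injective_of_surjective_of_finrank_eq {C D : Type*} [AddCommGroup C] [Module O C]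
    [Module.Finite O C] [Module.IsTorsionFree O C] [AddCommGroup D] [Module O D] {f : C →ₗ[O] D}
    (hf : Function.Surjective f) (h : Module.finrank O C = Module.finrank O D) :
    Function.Injective f := by
  have hker : Module.rank O (LinearMap.ker f) = 0 := by
    have hrank := Submodule.rank_quotient_add_rank (LinearMap.ker f)
    rw [← Module.finrank_eq_rank O C, h, ← (f.quotKerEquivOfSurjective hf).finrank_eq,
      Module.finrank_eq_rank] at hrank
    exact Cardinal.eq_of_add_eq_add_left (hrank.trans (add_zero _).symm)
      (Module.rank_lt_aleph0 O _)
  refine (injective_iff_map_eq_zero f).2 fun x hx => ?_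
  obtain ⟨a, ha⟩ := (Module.rank_eq_zero_iff_isTorsion.1 hker) (x := ⟨x, hx⟩)
  exact (smul_eq_zero.1 (congrArg Subtype.val ha)).resolve_left (nonZeroDivisors.ne_zero a.2)

variable [CommRing M] [Algebra O M] [Algebra C M] [IsScalarTower O C M] [Module.Finite O M]

-- Replacing `C` by its image `D` in `M` does not change `M ⊗ M`, so `M` is flat of rank `d` over
-- `D`. Comparing degrees over `O`, the kernel of `C → D` is torsion.
theorem injective_algebraMap_of_rankAtStalk_tensor_self [Module.IsTorsionFree O C]
    [Module.Flat M (M ⊗[C] M)] (d : ℕ) (hd₀ : d ≠ 0)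
    (hd : ∀ P, Module.rankAtStalk (R := M) (M ⊗[C] M) P = d)
    (hrank : Module.finrank O M = d * Module.finrank O C) :
    Function.Injective (algebraMap C M) := by
  let f := (IsScalarTower.toAlgHom O C M).rangeRestrict
  let D := (IsScalarTower.toAlgHom O C M).range
  have hf : Function.Surjective f := AlgHom.rangeRestrict_surjective _
  let : Algebra C D := f.toRingHom.toAlgebra
  have : IsScalarTower C D M := IsScalarTower.of_algebraMap_eq fun _ => rfl
  have : Module.Finite O D := Module.Finite.of_surjective f.toLinearMap hf
  have : Module.Finite D M := Module.Finite.of_restrictScalars_finite O D M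
  have : TensorProduct.CompatibleSMul C D M M := .of_algebraMap_surjective _ _ hf
  let e : M ⊗[C] M ≃ₗ[M] M ⊗[D] M :=
    (Algebra.TensorProduct.equivOfCompatibleSMul D C M M M).toLinearEquiv
  have : Module.Flat M (M ⊗[D] M) := Module.Flat.of_linearEquiv e.symm
  have hdD (P) : Module.rankAtStalk (R := M) (M ⊗[D] M) P = d := by
    rw [← Module.rankAtStalk_eq_of_equiv e, hd]
  have hDM : Function.Injective (algebraMap D M) := Subtype.val_injective
  have := flat_of_rankAtStalk_baseChange hDM d hdD
  have hDrank : Module.finrank O M = d * Module.finrank O D :=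
    finrank_eq_mul_of_rankAtStalk_eq d (rankAtStalk_eq_of_rankAtStalk_baseChange hDM d hdD)
  exact hDM.comp (injective_of_surjective_of_finrank_eq (f := f.toLinearMap) hf
    (Nat.eq_of_mul_eq_mul_left (Nat.pos_of_ne_zero hd₀) (hrank.symm.trans hDrank)))

end Degree

/-! ### Descent along split coequalizers -/

section SplitDescent

namespace CommGroupScheme

variable {B M : CommRingCat.{u}} {φ : B ⟶ M} {X Y Z : Under B}

theorem pushout_map_right_isoPushout_inv (f : X ⟶ Y) {MX MY : CommRingCat.{u}}
    {jX : M ⟶ MX} {kX : X.right ⟶ MX} (hX : IsPushout φ X.hom jX kX)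
    {jY : M ⟶ MY} {kY : Y.right ⟶ MY} (hY : IsPushout φ Y.hom jY kY)
    {mf : MX ⟶ MY} (hj : jX ≫ mf = jY) (hk : kX ≫ mf = f.right ≫ kY) :
    hX.flip.isoPushout.inv ≫ mf = ((Under.pushout φ).map f).right ≫ hY.flip.isoPushout.inv := by
  let m : pushout X.hom φ ⟶ pushout Y.hom φ := ((Under.pushout φ).map f).right
  have hinl : pushout.inl X.hom φ ≫ m = f.right ≫ pushout.inl Y.hom φ := pushout.inl_desc _ _ _
  have hinr : pushout.inr X.hom φ ≫ m = pushout.inr Y.hom φ := pushout.inr_desc _ _ _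
  change hX.flip.isoPushout.inv ≫ mf = m ≫ hY.flip.isoPushout.inv
  refine pushout.hom_ext ?_ ?_
  · rw [IsPushout.inl_isoPushout_inv_assoc, hk, reassoc_of% hinl, IsPushout.inl_isoPushout_inv]
  · rw [IsPushout.inr_isoPushout_inv_assoc, hj, reassoc_of% hinr, IsPushout.inr_isoPushout_inv]

theorem isLimit_fork_of_isPushout {f g : X ⟶ Y} {i : Z ⟶ X} {h : i ≫ f = i ≫ g}
    (hi : IsLimit (Fork.ofι i h)) (hφ : φ.hom.Flat) {MX MY MZ : CommRingCat.{u}}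
    {jX : M ⟶ MX} {kX : X.right ⟶ MX} (hX : IsPushout φ X.hom jX kX)
    {jY : M ⟶ MY} {kY : Y.right ⟶ MY} (hY : IsPushout φ Y.hom jY kY)
    {jZ : M ⟶ MZ} {kZ : Z.right ⟶ MZ} (hZ : IsPushout φ Z.hom jZ kZ)
    {mf mg : MX ⟶ MY} (hjf : jX ≫ mf = jY) (hkf : kX ≫ mf = f.right ≫ kY)
    (hjg : jX ≫ mg = jY) (hkg : kX ≫ mg = g.right ≫ kY)
    {mi : MZ ⟶ MX} (hji : jZ ≫ mi = jX) (hki : kZ ≫ mi = i.right ≫ kX)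
    (hm : mi ≫ mf = mi ≫ mg) : Nonempty (IsLimit (Fork.ofι mi hm)) := by
  have := CommRingCat.Under.preservesFiniteLimits_of_flat φ hφ
  exact ⟨Fork.isLimitEquivOfIsos _ _ hX.flip.isoPushout.symm hY.flip.isoPushout.symm
    hZ.flip.isoPushout.symm (pushout_map_right_isoPushout_inv f hX hY hjf hkf)
    (pushout_map_right_isoPushout_inv g hX hY hjg hkg)
    (pushout_map_right_isoPushout_inv i hZ hX hji hki)
    (isLimitForkMapOfIsLimit (Under.pushout φ ⋙ Under.forget M) h hi)⟩

theorem isPushout_of_isSplitEqualizer {f g : X ⟶ Y} {i : Z ⟶ X} {h : i ≫ f = i ≫ g}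
    (hi : IsLimit (Fork.ofι i h)) (hφ : φ.hom.Flat) {MX MY : CommRingCat.{u}}
    {jX : M ⟶ MX} {kX : X.right ⟶ MX} (hX : IsPushout φ X.hom jX kX)
    {jY : M ⟶ MY} {kY : Y.right ⟶ MY} (hY : IsPushout φ Y.hom jY kY)
    {mf mg : MX ⟶ MY} (hjf : jX ≫ mf = jY) (hkf : kX ≫ mf = f.right ≫ kY)
    (hjg : jX ≫ mg = jY) (hkg : kX ≫ mg = g.right ≫ kY)
    {e : X.right ⟶ MX} (c : IsSplitEqualizer mf mg e) (hc : kX ≫ c.leftRetraction = 𝟙 X.right) :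
    IsPushout φ Z.hom (jX ≫ c.leftRetraction) i.right := by
  have hZ : IsPushout φ Z.hom _ _ := .of_hasPushout φ Z.hom
  let mi : pushout φ Z.hom ⟶ MX := hZ.desc jX (i.right ≫ kX) (by simp [hX.w])
  have hji : pushout.inl _ _ ≫ mi = jX := hZ.inl_desc _ _ _
  have hki : pushout.inr _ _ ≫ mi = i.right ≫ kX := hZ.inr_desc _ _ _
  have hm : mi ≫ mf = mi ≫ mg := by
    refine hZ.hom_ext ?_ ?_
    · rw [reassoc_of% hji, reassoc_of% hji, hjf, hjg]
    · have := congr($(h).right)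
      simp only [Under.comp_right] at this
      rw [reassoc_of% hki, reassoc_of% hki, hkf, hkg, reassoc_of% this]
  obtain ⟨hmi⟩ := isLimit_fork_of_isPushout hi hφ hX hY hZ hjf hkf hjg hkg hji hki hm
  let a : pushout φ Z.hom ≅ X.right := hmi.conePointUniqueUpToIso c.isEqualizer
  have ha : a.hom = mi ≫ c.leftRetraction := by
    have hae : a.hom ≫ e = mi := hmi.conePointUniqueUpToIso_hom_comp c.isEqualizer .zero
    rw [← hae, Category.assoc, c.ι_leftRetraction, Category.comp_id]
  refine hZ.of_iso (Iso.refl _) (Iso.refl _) (Iso.refl _) a (by simp) (by simp) ?_ ?_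
  · rw [ha, reassoc_of% hji, Iso.refl_hom, Category.id_comp]
  · rw [ha, reassoc_of% hki, hc, Iso.refl_hom, Category.id_comp, Category.comp_id]

theorem exists_isPushout_of_isSplitEqualizer (hφ : φ.hom.Flat) {N W MN MW : CommRingCat.{u}}
    {β : B ⟶ N} {f g : N ⟶ W} (hfg : β ≫ f = β ≫ g) {jM : M ⟶ MN} {jN : N ⟶ MN}
    (hMN : IsPushout φ β jM jN) {kM : M ⟶ MW} {kW : W ⟶ MW} (hMW : IsPushout φ (β ≫ f) kM kW)
    {mf mg : MN ⟶ MW} (hMf : jM ≫ mf = kM) (hNf : jN ≫ mf = f ≫ kW) (hMg : jM ≫ mg = kM)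
    (hNg : jN ≫ mg = g ≫ kW) {e : N ⟶ MN} (c : IsSplitEqualizer mf mg e)
    (hc : jN ≫ c.leftRetraction = 𝟙 N) :
    ∃ (N' : CommRingCat.{u}) (i : N' ⟶ N) (β' : B ⟶ N'),
      i ≫ f = i ≫ g ∧ IsPushout φ β' (jM ≫ c.leftRetraction) i := by
  let f' : Under.mk β ⟶ Under.mk (β ≫ f) := Under.homMk f rfl
  let g' : Under.mk β ⟶ Under.mk (β ≫ f) := Under.homMk g hfg.symm
  exact ⟨_, (equalizer.ι f' g').right, _, congr($(equalizer.condition f' g').right),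
    isPushout_of_isSplitEqualizer (equalizerIsEqualizer f' g') hφ hMN hMW hMf hNf hMg hNg c hc⟩

theorem isPullback_of_isPushout_appTop {S E P : Scheme.{u}} [IsAffine S] [IsAffine E] [IsAffine P]
    {π : E ⟶ S} {ρ : P ⟶ E} {N : CommRingCat.{u}} {β : Γ(S, ⊤) ⟶ N} {i : N ⟶ Γ(P, ⊤)}
    (h : IsPushout π.appTop β ρ.appTop i) :
    IsPullback ρ (P.isoSpec.hom ≫ Spec.map i) π (Spec.map β ≫ S.isoSpec.inv) := by
  refine (h.op.map Scheme.Spec).flip.of_iso P.isoSpec.symm E.isoSpec.symm (Iso.refl _)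
    S.isoSpec.symm ?_ ?_ ?_ ?_
  · exact Scheme.isoSpec_inv_naturality _
  · simp
  · exact Scheme.isoSpec_inv_naturality _
  · simp

theorem exists_isPullback_of_isSplitCoequalizer {S E P W EP EW : Scheme.{u}} [IsAffine S]
    [IsAffine E] [IsAffine P] [IsAffine W] {π : E ⟶ S} [Flat π] {r : P ⟶ S} {f g : W ⟶ P}
    (hfg : f ≫ r = g ≫ r) {x₁ : EP ⟶ E} {x₂ : EP ⟶ P} (hEP : IsPullback x₁ x₂ π r)
    {w₁ : EW ⟶ E} {w₂ : EW ⟶ W} (hEW : IsPullback w₁ w₂ π (f ≫ r)) {ef eg : EW ⟶ EP}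
    (hf₁ : ef ≫ x₁ = w₁) (hf₂ : ef ≫ x₂ = w₂ ≫ f) (hg₁ : eg ≫ x₁ = w₁) (hg₂ : eg ≫ x₂ = w₂ ≫ g)
    {y : EP ⟶ P} (c : IsSplitCoequalizer ef eg y) (hc : c.rightSection ≫ x₂ = 𝟙 P) :
    ∃ (P' : Scheme.{u}) (p : P ⟶ P') (s : P' ⟶ S), IsAffine P' ∧ f ≫ p = g ≫ p ∧
      IsPullback (c.rightSection ≫ x₁) p π s := by
  have : IsAffine EP := .of_isIso hEP.isoPullback.hom
  have : IsAffine EW := .of_isIso hEW.isoPullback.hom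
  let cΓ : IsSplitEqualizer ef.appTop eg.appTop y.appTop :=
    { leftRetraction := c.rightSection.appTop
      rightRetraction := c.leftSection.appTop
      condition := by simp only [← Scheme.Hom.comp_appTop, c.condition]
      ι_leftRetraction := by
        simp only [← Scheme.Hom.comp_appTop, c.rightSection_π, Scheme.Hom.id_appTop]
      bottom_rightRetraction := by
        simp only [← Scheme.Hom.comp_appTop, c.leftSection_bottom, Scheme.Hom.id_appTop]
      top_rightRetraction := by simp only [← Scheme.Hom.comp_appTop, c.leftSection_top] }
  have hEW' := isPushout_appTop_of_isPullback hEW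
  rw [Scheme.Hom.comp_appTop] at hEW'
  obtain ⟨N', i, β', hi, hN⟩ := exists_isPushout_of_isSplitEqualizer (Scheme.Hom.flat_appTop π)
    (f := f.appTop) (g := g.appTop) (mf := ef.appTop) (mg := eg.appTop)
    (by simp only [← Scheme.Hom.comp_appTop, hfg]) (isPushout_appTop_of_isPullback hEP) hEW'
    (by simp only [← Scheme.Hom.comp_appTop, hf₁]) (by simp only [← Scheme.Hom.comp_appTop, hf₂])
    (by simp only [← Scheme.Hom.comp_appTop, hg₁]) (by simp only [← Scheme.Hom.comp_appTop, hg₂])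
    cΓ (by simp only [cΓ, ← Scheme.Hom.comp_appTop, hc, Scheme.Hom.id_appTop])
  rw [← Scheme.Hom.comp_appTop] at hN
  refine ⟨Spec N', P.isoSpec.hom ≫ Spec.map i, Spec.map β' ≫ S.isoSpec.inv, inferInstance, ?_,
    isPullback_of_isPushout_appTop hN⟩
  simp only [← Scheme.isoSpec_hom_naturality_assoc, ← Spec.map_comp, hi]

end CommGroupScheme

end SplitDescent

section Finrank

open scoped TensorProduct

namespace CommGroupScheme

theorem nonempty_linearEquiv_tensor_of_isPushout {C M N Z : Type u} [CommRing C] [CommRing M]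
    [CommRing N] [CommRing Z] [Algebra C M] [Algebra C N] [Algebra M Z]
    {b : CommRingCat.of N ⟶ CommRingCat.of Z}
    (h : IsPushout (CommRingCat.ofHom (algebraMap C M)) (CommRingCat.ofHom (algebraMap C N))
      (CommRingCat.ofHom (algebraMap M Z)) b) :
    Nonempty (M ⊗[C] N ≃ₗ[M] Z) := by
  have hMN := CommRingCat.isPushout_tensorProduct C M N
  let e := (hMN.isoIsPushout _ _ h).commRingCatIsoToRingEquiv
  have he : CommRingCat.ofHom (algebraMap M (M ⊗[C] N)) ≫ (hMN.isoIsPushout _ _ h).hom =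
      CommRingCat.ofHom (algebraMap M Z) := IsPushout.inl_isoIsPushout_hom _ _ hMN h
  exact ⟨(AlgEquiv.ofRingEquiv (f := e) fun m => congr($(he).hom m)).toLinearEquiv⟩

theorem rankAtStalk_eq_finrank_of_isDomain {O M : Type*} [CommRing O] [IsDomain O] [AddCommGroup M]
    [Module O M] [Module.Finite O M] [Module.Flat O M] (P : PrimeSpectrum O) :
    Module.rankAtStalk M P = Module.finrank O M := by
  rw [← Ideal.finrank_fiber_eq_rankAtStalk, Ideal.finrank_fiber_eq_finrank]

theorem finrank_appTop {A B : Scheme.{u}} [IsAffine A] [IsAffine B] (f : A ⟶ B) [IsFinite f]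
    [Flat f] (b : B) : f.appTop.hom.finrank (B.isoSpec.hom b) = f.finrank b := by
  have hfin : f.appTop.hom.Finite := Scheme.Hom.finite_appTop f
  have hflat : f.appTop.hom.Flat := Scheme.Hom.flat_appTop f
  have : IsFinite (Spec.map f.appTop) := (IsFinite.SpecMap_iff _).2 hfin
  have : Flat (Spec.map f.appTop) := Flat.SpecMap_iff.2 hflat
  rw [← Scheme.Hom.finrank_SpecMap_eq_finrank hfin hflat]
  exact (Scheme.Hom.finrank_of_isPullback A.isoSpec.hom f (Spec.map f.appTop) B.isoSpec.hom
    (.of_horiz_isIso ⟨Scheme.isoSpec_hom_naturality f⟩) b).symm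

theorem finrank_appTop_eq {A B : Scheme.{u}} [IsAffine A] [IsAffine B] {f : A ⟶ B} [IsFinite f]
    [Flat f] {d : ℕ} (hd : ∀ b, f.finrank b = d) (P : PrimeSpectrum Γ(B, ⊤)) :
    f.appTop.hom.finrank P = d := by
  obtain ⟨b, rfl⟩ := B.isoSpec.hom.surjective P
  rw [finrank_appTop, hd]

theorem finrank_eq_finrank_appTop {A S : Scheme.{u}} [IsAffine A] [IsAffine S] [IsIntegral S]
    (a : A ⟶ S) [IsFinite a] [Flat a] (s : S) :
    letI := a.appTop.hom.toAlgebra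
    a.finrank s = Module.finrank Γ(S, ⊤) Γ(A, ⊤) := by
  have hfin : a.appTop.hom.Finite := Scheme.Hom.finite_appTop a
  have hflat : a.appTop.hom.Flat := Scheme.Hom.flat_appTop a
  algebraize [a.appTop.hom]
  rw [← finrank_appTop]
  exact rankAtStalk_eq_finrank_of_isDomain _

theorem nonempty_linearEquiv_tensor_of_isPullback {A B N Z : Scheme.{u}} [IsAffine A] [IsAffine B]
    [IsAffine N] {f : A ⟶ B} {g : N ⟶ B} {q : Z ⟶ A} {r : Z ⟶ N} (h : IsPullback q r f g) :
    letI := f.appTop.hom.toAlgebra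
    letI := g.appTop.hom.toAlgebra
    letI := q.appTop.hom.toAlgebra
    Nonempty (Γ(A, ⊤) ⊗[Γ(B, ⊤)] Γ(N, ⊤) ≃ₗ[Γ(A, ⊤)] Γ(Z, ⊤)) :=
  let := f.appTop.hom.toAlgebra
  let := g.appTop.hom.toAlgebra
  let := q.appTop.hom.toAlgebra
  nonempty_linearEquiv_tensor_of_isPushout (C := Γ(B, ⊤)) (M := Γ(A, ⊤)) (N := Γ(N, ⊤))
    (Z := Γ(Z, ⊤)) (isPushout_appTop_of_isPullback h)

theorem flat_tensor_and_rankAtStalk_eq_of_isPullback {A B N Z : Scheme.{u}} [IsAffine A]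
    [IsAffine B] [IsAffine N] {f : A ⟶ B} {g : N ⟶ B} {q : Z ⟶ A} {r : Z ⟶ N}
    (h : IsPullback q r f g) [IsFinite q] [Flat q] {d : ℕ} (hd : ∀ a, q.finrank a = d) :
    letI := f.appTop.hom.toAlgebra
    letI := g.appTop.hom.toAlgebra
    Module.Flat Γ(A, ⊤) (Γ(A, ⊤) ⊗[Γ(B, ⊤)] Γ(N, ⊤)) ∧
      ∀ P, Module.rankAtStalk (R := Γ(A, ⊤)) (Γ(A, ⊤) ⊗[Γ(B, ⊤)] Γ(N, ⊤)) P = d := by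
  have : IsAffine Z := .of_isIso h.isoPullback.hom
  have hflat : q.appTop.hom.Flat := Scheme.Hom.flat_appTop q
  algebraize [q.appTop.hom]
  let := f.appTop.hom.toAlgebra
  let := g.appTop.hom.toAlgebra
  obtain ⟨e⟩ := nonempty_linearEquiv_tensor_of_isPullback h
  exact ⟨.of_linearEquiv e, fun P =>
    congr($(Module.rankAtStalk_eq_of_equiv e) P).trans (finrank_appTop_eq hd P)⟩

theorem flat_of_isPullback_of_finrank_eq {A B N Z : Scheme.{u}} [IsAffine A] [IsAffine B]
    [IsAffine N] {f : A ⟶ B} {g : N ⟶ B} {q : Z ⟶ A} {r : Z ⟶ N} (h : IsPullback q r f g)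
    [IsIntegralHom f] (hf : Function.Injective f.appTop.hom) [IsFinite g] [IsFinite q] [Flat q]
    {d : ℕ} (hd : ∀ a, q.finrank a = d) : Flat g := by
  have hint : f.appTop.hom.IsIntegral := IsIntegralHom.isIntegral_app f _ (isAffineOpen_top _)
  have hfin : g.appTop.hom.Finite := Scheme.Hom.finite_appTop g
  let := f.appTop.hom.toAlgebra
  let := g.appTop.hom.toAlgebra
  have : Algebra.IsIntegral Γ(B, ⊤) Γ(A, ⊤) := ⟨hint⟩
  have : Module.Finite Γ(B, ⊤) Γ(N, ⊤) := hfin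
  obtain ⟨hflat, hrank⟩ := flat_tensor_and_rankAtStalk_eq_of_isPullback h hd
  exact HasRingHomProperty.iff_of_isAffine.2 (flat_of_rankAtStalk_baseChange hf d hrank)

theorem surjective_of_injective_appTop {A B : Scheme.{u}} [IsAffine A] [IsAffine B] (f : A ⟶ B)
    [IsIntegralHom f] (hf : Function.Injective f.appTop.hom) : Surjective f := by
  have hint : f.appTop.hom.IsIntegral := IsIntegralHom.isIntegral_app f _ (isAffineOpen_top _)
  rw [MorphismProperty.arrow_mk_iso_iff @Surjective (arrowIsoSpecΓOfIsAffine f)]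
  let := f.appTop.hom.toAlgebra
  have : Algebra.IsIntegral Γ(B, ⊤) Γ(A, ⊤) := ⟨hint⟩
  have : FaithfulSMul Γ(B, ⊤) Γ(A, ⊤) := (faithfulSMul_iff_algebraMap_injective _ _).2 hf
  exact ⟨Algebra.IsIntegral.comap_surjective Γ(B, ⊤) Γ(A, ⊤)⟩

theorem appTop_injective_of_isPullback {A B S Z : Scheme.{u}} [IsAffine A] [IsAffine B]
    [IsAffine S] [IsIntegral S] {f : A ⟶ B} {b : B ⟶ S} [IsFinite b] [Flat b] [IsFinite (f ≫ b)]
    [Flat (f ≫ b)] {q₁ q₂ : Z ⟶ A} (h : IsPullback q₁ q₂ f f) [IsFinite q₁] [Flat q₁] {d : ℕ}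
    (hd₀ : d ≠ 0) (hd : ∀ a, q₁.finrank a = d)
    (hrank : ∀ s, (f ≫ b).finrank s = d * b.finrank s) : Function.Injective f.appTop.hom := by
  have hA : (f ≫ b).appTop.hom.Finite := Scheme.Hom.finite_appTop _
  have hB : b.appTop.hom.Finite := Scheme.Hom.finite_appTop b
  have hBflat : b.appTop.hom.Flat := Scheme.Hom.flat_appTop b
  have hrank' := hrank (genericPoint S)
  rw [finrank_eq_finrank_appTop, finrank_eq_finrank_appTop] at hrank'
  algebraize [f.appTop.hom, b.appTop.hom, (f ≫ b).appTop.hom]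
  have : IsScalarTower Γ(S, ⊤) Γ(B, ⊤) Γ(A, ⊤) := .of_algebraMap_eq' (by
    change (f ≫ b).appTop.hom = _
    rw [Scheme.Hom.comp_appTop]
    rfl)
  obtain ⟨hflat, hrankAt⟩ := flat_tensor_and_rankAtStalk_eq_of_isPullback h hd
  exact injective_algebraMap_of_rankAtStalk_tensor_self (O := Γ(S, ⊤)) d hd₀ hrankAt hrank'

theorem flat_codescendsAlong_faithfullyFlat :
    RingHom.CodescendsAlong RingHom.Flat RingHom.FaithfullyFlat := by
  refine .mk _ RingHom.Flat.respectsIso fun R S T _ _ _ _ _ hS hT => ?_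
  rw [RingHom.flat_algebraMap_iff] at hT ⊢
  rw [RingHom.faithfullyFlat_algebraMap_iff] at hS
  exact Module.Flat.of_flat_tensorProduct (R := R) (M := T) S

instance flat_descendsAlong :
    MorphismProperty.DescendsAlong @Flat (@Surjective ⊓ @Flat ⊓ @QuasiCompact) :=
  HasRingHomProperty.descendsAlong_flat flat_codescendsAlong_faithfullyFlat

end CommGroupScheme

end Finrank

/-! ### Group objects and their quotients -/

section CommGrpForget

variable {C : Type u} [Category.{v} C] [CartesianMonoidalCategory C] [BraidedCategory C]

instance preservesLimitsOfShape_commGrpForget {J : Type w} [Category J] [HasLimitsOfShape J C] :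
    PreservesLimitsOfShape J (CommGrp.forget C) where
  preservesLimit {F} := by
    let L : CommGrp C :=
      { X := (limit (F ⋙ CommGrp.forget₂Grp C)).X
        comm := CommGrp.isCommMonObj_limit F }
    have : CreatesLimit F (CommGrp.forget₂Grp C) :=
      createsLimitOfFullyFaithfulOfIso L (Iso.refl _)
    have : PreservesLimit F (CommGrp.forget₂Grp C) := inferInstance
    have : PreservesLimit F (CommGrp.forget₂Grp C ⋙ Grp.forget C) := inferInstance
    exact this

instance reflectsIsomorphisms_commGrpForget : (CommGrp.forget C).ReflectsIsomorphisms where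
  reflects {A B} f hf := by
    have : IsIso f.hom.hom.hom := hf
    have : IsMonHom (asIso f.hom.hom.hom).hom := inferInstanceAs (IsMonHom f.hom.hom.hom)
    have hiso : f = (CommGrp.mkIso' (asIso f.hom.hom.hom)).hom := CommGrp.hom_ext _ _ rfl
    rw [hiso]
    infer_instance

open scoped CategoryTheory.MonObj

theorem commGrp_hom_zero (A B : CommGrp C) : (0 : A ⟶ B).hom.hom.hom = 1 := rfl

theorem exists_comp_eq_of_isLimit_kernelFork [HasFiniteLimits C] {A B D : CommGrp C} {i : A ⟶ B}
    {q : B ⟶ D} {w : i ≫ q = 0} (h : IsLimit (KernelFork.ofι i w)) {Z : C} (z : Z ⟶ B.X)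
    (hz : z ≫ q.hom.hom.hom = 1) : ∃ a : Z ⟶ A.X, a ≫ i.hom.hom.hom = z := by
  have h' := isLimitForkMapOfIsLimit (CommGrp.forget C) _ h
  have hz' : z ≫ (CommGrp.forget C).map q = z ≫ (CommGrp.forget C).map (0 : B ⟶ D) := by
    change z ≫ q.hom.hom.hom = z ≫ (1 : B.X ⟶ D.X)
    rw [hz, MonObj.comp_one]
  exact ⟨h'.lift (Fork.ofι z hz'), h'.fac (Fork.ofι z hz') .zero⟩

end CommGrpForget

section QuotientGroup

open scoped CategoryTheory.MonObj

variable {C : Type u} [Category.{v} C] [CartesianMonoidalCategory C]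

theorem lift_comp_comp_of_tensorHom_comp {P Q : C} [MonObj P] {p : P ⟶ Q} {m : Q ⊗ Q ⟶ Q}
    (hm : (p ⊗ₘ p) ≫ m = μ ≫ p) {Z : C} (a b : Z ⟶ P) :
    lift (a ≫ p) (b ≫ p) ≫ m = (a * b) ≫ p := by
  rw [← lift_map, Category.assoc, hm, Hom.mul_def, Category.assoc]

/-- The monoid structure on `Q` induced by a multiplication `m` that an epimorphism `p` from a
monoid object intertwines with the multiplication of its source. -/
abbrev monObjOfEpi {P Q : C} [MonObj P] (p : P ⟶ Q) [Epi p] [Epi ((p ⊗ₘ p) ⊗ₘ p)] (m : Q ⊗ Q ⟶ Q)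
    (hm : (p ⊗ₘ p) ≫ m = μ ≫ p) : MonObj Q where
  one := η ≫ p
  mul := m
  one_mul := by
    have hlift : p ≫ (λ_ Q).inv ≫ (η ≫ p) ▷ Q = lift ((1 : P ⟶ P) ≫ p) (𝟙 P ≫ p) := by
      ext <;> simp [Hom.one_def]
    rw [← cancel_epi (λ_ Q).inv, ← cancel_epi p, Iso.inv_hom_id, Category.comp_id,
      ← Category.assoc, ← Category.assoc, Category.assoc p, hlift,
      lift_comp_comp_of_tensorHom_comp hm, one_mul, Category.id_comp]
  mul_one := by
    have hlift : p ≫ (ρ_ Q).inv ≫ Q ◁ (η ≫ p) = lift (𝟙 P ≫ p) ((1 : P ⟶ P) ≫ p) := by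
      ext <;> simp [Hom.one_def]
    rw [← cancel_epi (ρ_ Q).inv, ← cancel_epi p, Iso.inv_hom_id, Category.comp_id,
      ← Category.assoc, ← Category.assoc, Category.assoc p, hlift,
      lift_comp_comp_of_tensorHom_comp hm, mul_one, Category.id_comp]
  mul_assoc := by
    let a : (P ⊗ P) ⊗ P ⟶ P := fst _ _ ≫ fst _ _
    let b : (P ⊗ P) ⊗ P ⟶ P := fst _ _ ≫ snd _ _
    let c : (P ⊗ P) ⊗ P ⟶ P := snd _ _
    have hleft : ((p ⊗ₘ p) ⊗ₘ p) ≫ m ▷ Q = lift (lift (a ≫ p) (b ≫ p) ≫ m) (c ≫ p) := by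
      ext
      · rw [Category.assoc, whiskerRight_fst, tensorHom_fst_assoc, lift_fst, ← Category.assoc]
        congr 1
        ext <;> simp [a, b]
      · simp [c]
    have hright : ((p ⊗ₘ p) ⊗ₘ p) ≫ (α_ Q Q Q).hom ≫ Q ◁ m =
        lift (a ≫ p) (lift (b ≫ p) (c ≫ p) ≫ m) := by
      ext
      · simp [a]
      · rw [Category.assoc, Category.assoc, whiskerLeft_snd, lift_snd, ← Category.assoc,
          ← Category.assoc]
        congr 1
        ext <;> simp [b, c]
    rw [← cancel_epi ((p ⊗ₘ p) ⊗ₘ p), reassoc_of% hleft, reassoc_of% hright]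
    simp only [lift_comp_comp_of_tensorHom_comp hm, mul_assoc]

/-- The group structure on `Q` induced by a multiplication `m` and an inversion `n` that an
epimorphism `p` from a group object intertwines with those of its source. -/
abbrev grpObjOfEpi {P Q : C} [GrpObj P] (p : P ⟶ Q) [Epi p] [Epi ((p ⊗ₘ p) ⊗ₘ p)]
    (m : Q ⊗ Q ⟶ Q) (hm : (p ⊗ₘ p) ≫ m = μ ≫ p) (n : Q ⟶ Q) (hn : p ≫ n = ι ≫ p) : GrpObj Q where
  toMonObj := monObjOfEpi p m hm
  inv := n
  left_inv := by
    have hinv := lift_comp_comp_of_tensorHom_comp hm (𝟙 P)⁻¹ (𝟙 P)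
    rw [inv_mul_cancel, Hom.one_def, Hom.inv_def, Category.id_comp] at hinv
    change lift n (𝟙 Q) ≫ m = toUnit Q ≫ η ≫ p
    rw [← cancel_epi p, comp_lift_assoc, hn]
    simpa using hinv
  right_inv := by
    have hinv := lift_comp_comp_of_tensorHom_comp hm (𝟙 P) (𝟙 P)⁻¹
    rw [mul_inv_cancel, Hom.one_def, Hom.inv_def, Category.id_comp] at hinv
    change lift (𝟙 Q) n ≫ m = toUnit Q ≫ η ≫ p
    rw [← cancel_epi p, comp_lift_assoc, hn]
    simpa using hinv

theorem exists_grpObj_of_effectiveEpi [BraidedCategory C] {P Q : C} [GrpObj P] [IsCommMonObj P]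
    (p : P ⟶ Q) [EffectiveEpi p] [EffectiveEpi (p ⊗ₘ p)] [Epi ((p ⊗ₘ p) ⊗ₘ p)]
    (hmul : ∀ {Z : C} (g₁ g₂ h₁ h₂ : Z ⟶ P), g₁ ≫ p = g₂ ≫ p → h₁ ≫ p = h₂ ≫ p →
      (g₁ * h₁) ≫ p = (g₂ * h₂) ≫ p)
    (hinv : ∀ {Z : C} (g₁ g₂ : Z ⟶ P), g₁ ≫ p = g₂ ≫ p → g₁⁻¹ ≫ p = g₂⁻¹ ≫ p) :
    ∃ (_ : GrpObj Q), IsCommMonObj Q ∧ IsMonHom p := by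
  have hmul' {Z : C} (g₁ g₂ : Z ⟶ P ⊗ P) (h : g₁ ≫ (p ⊗ₘ p) = g₂ ≫ (p ⊗ₘ p)) :
      g₁ ≫ μ ≫ p = g₂ ≫ μ ≫ p := by
    have := hmul (g₁ ≫ fst P P) (g₂ ≫ fst P P) (g₁ ≫ snd P P) (g₂ ≫ snd P P)
      (by simpa using h =≫ fst Q Q) (by simpa using h =≫ snd Q Q)
    rwa [Hom.mul_def, Hom.mul_def, ← comp_lift, ← comp_lift, lift_fst_snd, Category.comp_id,
      Category.comp_id, Category.assoc, Category.assoc] at this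
  let m : Q ⊗ Q ⟶ Q := EffectiveEpi.desc (p ⊗ₘ p) (μ ≫ p) hmul'
  have hm : (p ⊗ₘ p) ≫ m = μ ≫ p := EffectiveEpi.fac _ _ _
  let n : Q ⟶ Q := EffectiveEpi.desc p (ι ≫ p) fun g₁ g₂ h => by
    simpa [Hom.inv_def] using hinv _ _ h
  have hn : p ≫ n = ι ≫ p := EffectiveEpi.fac _ _ _
  have hcomm : (β_ Q Q).hom ≫ m = m := by
    rw [← cancel_epi (p ⊗ₘ p), BraidedCategory.braiding_naturality_assoc, hm,
      IsCommMonObj.mul_comm_assoc]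
  let : GrpObj Q := grpObjOfEpi p m hm n hn
  exact ⟨this, ⟨hcomm⟩, ⟨rfl, hm.symm⟩⟩

theorem isMonHom_of_epi_comp {P Q T : C} [MonObj P] [MonObj Q] [MonObj T] (p : P ⟶ Q) (g : Q ⟶ T)
    [IsMonHom p] [IsMonHom (p ≫ g)] [Epi (p ⊗ₘ p)] : IsMonHom g where
  one_hom := by
    rw [← IsMonHom.one_hom p, Category.assoc, IsMonHom.one_hom]
  mul_hom := by
    rw [← cancel_epi (p ⊗ₘ p), ← IsMonHom.mul_hom_assoc, IsMonHom.mul_hom,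
      tensorHom_comp_tensorHom_assoc]

end QuotientGroup

instance over_effectiveEpi_of_left {T : Type u} [Category.{v} T] {S : T} {X Y : Over S} (f : X ⟶ Y)
    [EffectiveEpi f.left] : EffectiveEpi f := by
  have hdesc {W : Over S} (e : X ⟶ W)
      (h : ∀ {Z : Over S} (g₁ g₂ : Z ⟶ X), g₁ ≫ f = g₂ ≫ f → g₁ ≫ e = g₂ ≫ e) :
      ∀ {Z : T} (g₁ g₂ : Z ⟶ X.left), g₁ ≫ f.left = g₂ ≫ f.left → g₁ ≫ e.left = g₂ ≫ e.left := by
    intro Z g₁ g₂ hg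
    have hw : g₂ ≫ X.hom = g₁ ≫ X.hom := by
      rw [← Over.w f, ← Category.assoc, ← hg, Category.assoc]
    exact congrArg CommaMorphism.left (h (Z := Over.mk (g₁ ≫ X.hom)) (Over.homMk g₁ rfl)
      (Over.homMk g₂ hw) (Over.OverMorphism.ext hg))
  exact ⟨⟨{
    desc := fun {W} e h => Over.homMk (EffectiveEpi.desc f.left e.left (hdesc e h)) (by
      rw [← cancel_epi f.left, ← Category.assoc, EffectiveEpi.fac, Over.w, Over.w])
    fac := fun e h => Over.OverMorphism.ext (EffectiveEpi.fac f.left e.left (hdesc e h))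
    uniq := fun e h m hm => Over.OverMorphism.ext
      (EffectiveEpi.uniq f.left e.left (hdesc e h) _ (congrArg CommaMorphism.left hm)) }⟩⟩

/-! ### Short exact sequences of group schemes -/

namespace CommGroupScheme

/-- Faithfully flat and quasi-compact morphisms, the coverings of fpqc descent. -/
abbrev fpqc : MorphismProperty Scheme.{u} := @Surjective ⊓ @Flat ⊓ @QuasiCompact

namespace fpqc

instance isStableUnderBaseChange : fpqc.{u}.IsStableUnderBaseChange :=
  have : (@Surjective ⊓ @Flat : MorphismProperty Scheme.{u}).IsStableUnderBaseChange := .inf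
  .inf

instance isStableUnderComposition : fpqc.{u}.IsStableUnderComposition where
  comp_mem f g hf hg := by
    obtain ⟨⟨_, _⟩, _⟩ := hf
    obtain ⟨⟨_, _⟩, _⟩ := hg
    exact ⟨⟨inferInstance, inferInstance⟩, inferInstance⟩

theorem effectiveEpi {X Y : Scheme.{u}} {f : X ⟶ Y} (hf : fpqc f) : EffectiveEpi f := by
  obtain ⟨⟨_, _⟩, _⟩ := hf
  infer_instance

variable {S : Scheme.{u}} {X Y Z W : Over S}

theorem effectiveEpi_over {f : X ⟶ Y} (hf : fpqc f.left) : EffectiveEpi f :=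
  have := hf.effectiveEpi
  over_effectiveEpi_of_left f

theorem tensorHom {f : X ⟶ Y} {g : Z ⟶ W} (hf : fpqc f.left) (hg : fpqc g.left) :
    fpqc (f ⊗ₘ g).left := by
  rw [Over.tensorHom_left]
  exact MorphismProperty.pullbackMap (P := fpqc) hf hg (Over.w f).symm (Over.w g).symm

theorem isFinite_of_isPullback {W X Y Z : Scheme.{u}} [IsAffine Y] [IsAffine Z] {f : W ⟶ X}
    {g : W ⟶ Y} {h : X ⟶ Z} {k : Y ⟶ Z} (sq : IsPullback f g h k) (hh : fpqc h) [IsFinite f] :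
    IsFinite k := by
  have : UniversallyClosed k := MorphismProperty.of_isPullback_of_descendsAlong
    (P := @UniversallyClosed) (Q := fpqc) sq hh inferInstance
  have : LocallyOfFiniteType k := MorphismProperty.of_isPullback_of_descendsAlong
    (P := @LocallyOfFiniteType) (Q := fpqc) sq hh inferInstance
  have : IsProper k := ⟨⟩
  exact IsFinite.iff_isProper_and_isAffineHom.2 ⟨inferInstance, inferInstance⟩

end fpqc

variable {O : Type u} [CommRing O]

variable (O) in
/-- The functor sending a group scheme to its underlying scheme; its action on morphisms is
`schemeMap`. -/
noncomputable abbrev toScheme : CommGroupScheme O ⥤ Scheme.{u} := CommGrp.forget _ ⋙ Over.forget _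

variable {A B D A' B' D' X Y Z : CommGroupScheme O}

theorem isPullback_schemeMap {W X Y Z : CommGroupScheme O} {f : W ⟶ X} {g : W ⟶ Y} {h : X ⟶ Z}
    {k : Y ⟶ Z} (sq : IsPullback f g h k) :
    IsPullback (schemeMap f) (schemeMap g) (schemeMap h) (schemeMap k) :=
  sq.map (toScheme O)

theorem schemeMap_comp_structureMap (f : X ⟶ Y) :
    schemeMap f ≫ Y.structureMap = X.structureMap := Over.w f.hom.hom.hom

theorem schemeMap_comp (f : X ⟶ Y) (g : Y ⟶ Z) :
    schemeMap (f ≫ g) = schemeMap f ≫ schemeMap g := rfl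

instance isIso_schemeMap (f : X ⟶ Y) [IsIso f] : IsIso (schemeMap f) :=
  inferInstanceAs (IsIso ((toScheme O).map f))

theorem epi_of_fpqc {q : B ⟶ D} (h : fpqc (schemeMap q)) : Epi q :=
  have := h.effectiveEpi
  have : Epi ((toScheme O).map q) := inferInstanceAs (Epi (schemeMap q))
  (toScheme O).epi_of_epi_map this

theorem nonempty_isLimit_kernelFork {i : A ⟶ B} {q : B ⟶ D} [Mono i] (w : i ≫ q = 0)
    (h : ∀ {Z : CommGroupScheme O} (z : Z ⟶ B), z ≫ q = 0 → ∃ a, a ≫ i = z) :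
    Nonempty (IsLimit (KernelFork.ofι i w)) :=
  ⟨KernelFork.IsLimit.ofι' i w fun z hz => ⟨(h z hz).choose, (h z hz).choose_spec⟩⟩

namespace IsFiniteFlat

theorem isAffine (hX : IsFiniteFlat X) : IsAffine X.X.left :=
  have := hX.finite
  isAffine_of_isAffineHom X.structureMap

theorem isFinite_schemeMap (hX : IsFiniteFlat X) (hY : IsFiniteFlat Y) (f : X ⟶ Y) :
    IsFinite (schemeMap f) := by
  have := hX.finite
  have := hY.finite
  have : IsFinite (schemeMap f ≫ Y.structureMap) := by rwa [schemeMap_comp_structureMap]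
  exact IsFinite.of_comp (schemeMap f) Y.structureMap

theorem fpqc_schemeMap (hX : IsFiniteFlat X) (hY : IsFiniteFlat Y) (f : X ⟶ Y)
    [Flat (schemeMap f)] [Surjective (schemeMap f)] : fpqc (schemeMap f) :=
  have := hX.isFinite_schemeMap hY f
  ⟨⟨inferInstance, inferInstance⟩, inferInstance⟩

theorem of_schemeMap (hY : IsFiniteFlat Y) (f : X ⟶ Y) [IsFinite (schemeMap f)]
    [Flat (schemeMap f)] : IsFiniteFlat X := by
  have := hY.finite
  have := hY.flat
  constructor
  · rw [← schemeMap_comp_structureMap f]; infer_instance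
  · rw [← schemeMap_comp_structureMap f]; infer_instance

theorem of_iso (hY : IsFiniteFlat Y) (e : X ≅ Y) : IsFiniteFlat X :=
  hY.of_schemeMap e.hom

theorem isClosedFlatSubgroup (hX : IsFiniteFlat X) (hY : IsFiniteFlat Y) (f : X ⟶ Y) [Mono f] :
    IsClosedFlatSubgroup f where
  closed := by
    have := hX.isFinite_schemeMap hY f
    have : Mono (schemeMap f) := inferInstanceAs (Mono ((toScheme O).map f))
    exact (IsClosedImmersion.iff_isFinite_and_mono _).2 ⟨inferInstance, inferInstance⟩
  flat := hX.flat

end IsFiniteFlat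

namespace IsShortExact

variable {i : A ⟶ B} {q : B ⟶ D}

theorem mono (h : IsShortExact i q) : Mono i := by
  obtain ⟨hk⟩ := h.isKernel
  exact ⟨fun a b hab => Fork.IsLimit.hom_ext hk hab⟩

theorem exists_lift (h : IsShortExact i q) {Z : CommGroupScheme O} (z : Z ⟶ B) (hz : z ≫ q = 0) :
    ∃ a, a ≫ i = z := by
  obtain ⟨hk⟩ := h.isKernel
  exact ⟨hk.lift (KernelFork.ofι z hz), hk.fac (KernelFork.ofι z hz) .zero⟩

open scoped CategoryTheory.MonObj in
theorem exists_eq_mul (h : IsShortExact i q) {Z : Over (Spec (CommRingCat.of O))}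
    {g₁ g₂ : Z ⟶ B.X} (hg : g₁ ≫ q.hom.hom.hom = g₂ ≫ q.hom.hom.hom) :
    ∃ a : Z ⟶ A.X, g₁ = g₂ * a ≫ i.hom.hom.hom := by
  obtain ⟨hk⟩ := h.isKernel
  obtain ⟨a, ha⟩ := exists_comp_eq_of_isLimit_kernelFork hk (g₁ / g₂) (by
    rw [GrpObj.div_comp, hg, div_self'])
  exact ⟨a, by rw [ha, mul_div_cancel]⟩

theorem fpqc_schemeMap (h : IsShortExact i q) (hB : IsFiniteFlat B) (hD : IsFiniteFlat D) :
    fpqc (schemeMap q) :=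
  have := h.flat
  have := h.surjective
  hB.fpqc_schemeMap hD q

theorem epi (h : IsShortExact i q) (hB : IsFiniteFlat B) (hD : IsFiniteFlat D) : Epi q :=
  epi_of_fpqc (h.fpqc_schemeMap hB hD)

open scoped CategoryTheory.MonObj in
theorem exists_desc (h : IsShortExact i q) (hB : IsFiniteFlat B) (hD : IsFiniteFlat D)
    (f : B ⟶ X) (hf : i ≫ f = 0) : ∃ g, q ≫ g = f := by
  have hq : fpqc q.hom.hom.hom.left := h.fpqc_schemeMap hB hD
  have := hq.effectiveEpi_over
  have := (hq.tensorHom hq).effectiveEpi_over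
  have hf' : i.hom.hom.hom ≫ f.hom.hom.hom = 1 := congrArg (fun f => f.hom.hom.hom) hf
  let g : D.X ⟶ X.X := EffectiveEpi.desc q.hom.hom.hom f.hom.hom.hom fun g₁ g₂ hg => by
    obtain ⟨a, rfl⟩ := h.exists_eq_mul hg
    rw [MonObj.mul_comp, Category.assoc, hf', MonObj.comp_one, mul_one]
  have hg : q.hom.hom.hom ≫ g = f.hom.hom.hom := EffectiveEpi.fac _ _ _
  have : IsMonHom (q.hom.hom.hom ≫ g) := by rw [hg]; infer_instance
  have : IsMonHom g := isMonHom_of_epi_comp q.hom.hom.hom g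
  exact ⟨InducedCategory.homMk (Grp.homMk g), CommGrp.hom_ext _ _ hg⟩

theorem of_isPullback (h : IsShortExact i q) {t : B' ⟶ B} {q' : B' ⟶ D'} {g : D' ⟶ D}
    (sq : IsPullback t q' q g) {i' : A ⟶ B'} (hi : i' ≫ t = i) (w : i' ≫ q' = 0) :
    IsShortExact i' q' := by
  have := h.flat
  have := h.surjective
  have sq' := isPullback_schemeMap sq
  have : Mono i' := by
    have : Mono (i' ≫ t) := hi ▸ h.mono
    exact mono_of_mono _ t
  refine ⟨w, nonempty_isLimit_kernelFork w fun z hz => ?_,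
    MorphismProperty.of_isPullback sq' inferInstance,
    MorphismProperty.of_isPullback sq' inferInstance⟩
  obtain ⟨a, ha⟩ := h.exists_lift (z ≫ t) (by rw [Category.assoc, sq.w, reassoc_of% hz, zero_comp])
  exact ⟨a, sq.hom_ext (by rw [Category.assoc, hi, ha]) (by rw [Category.assoc, w, hz, comp_zero])⟩

theorem isFiniteFlat_of_isPullback (h : IsShortExact i q) (hB : IsFiniteFlat B)
    (hD : IsFiniteFlat D) (hD' : IsFiniteFlat D') {t : B' ⟶ B} {q' : B' ⟶ D'} {g : D' ⟶ D}
    (sq : IsPullback t q' q g) : IsFiniteFlat B' := by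
  have sq' := isPullback_schemeMap sq
  have := h.flat
  have := hB.isFinite_schemeMap hD q
  have : Flat (schemeMap q') := MorphismProperty.of_isPullback sq' inferInstance
  have : IsFinite (schemeMap q') := MorphismProperty.of_isPullback sq' inferInstance
  exact hD'.of_schemeMap q'

theorem comp_isIso (h : IsShortExact i q) (α : A' ⟶ A) (δ : D ⟶ D') [IsIso α] [IsIso δ] :
    IsShortExact (α ≫ i) (q ≫ δ) := by
  have := h.mono
  have := h.flat
  have := h.surjective
  have w : (α ≫ i) ≫ q ≫ δ = 0 := by simp [reassoc_of% h.comp_eq_zero]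
  refine ⟨w, nonempty_isLimit_kernelFork w fun z hz => ?_,
    by rw [schemeMap_comp]; infer_instance, by rw [schemeMap_comp]; infer_instance⟩
  obtain ⟨a, ha⟩ := h.exists_lift z (by
    rwa [← Category.assoc, Preadditive.IsIso.comp_right_eq_zero] at hz)
  exact ⟨a ≫ inv α, by simp [ha]⟩

-- The inverse of `f` is obtained by descending `x + a ≫ i` along `y : B ×_D B' ⟶ B'`, where `x` is
-- the other projection and `y - x ≫ f` factors through `a`.
theorem isIso_of_comp_eq {i' : A ⟶ B'} {q' : B' ⟶ D} (h : IsShortExact i q)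
    (h' : IsShortExact i' q') (hB : IsFiniteFlat B) (hB' : IsFiniteFlat B') (hD : IsFiniteFlat D)
    (f : B ⟶ B') (hi : i ≫ f = i') (hq : f ≫ q' = q) : IsIso f := by
  have sq := IsPullback.of_hasPullback q q'
  set x := pullback.fst q q'
  set y := pullback.snd q q'
  have hw : i ≫ q = 0 ≫ q' := by simp [h.comp_eq_zero]
  have hE := h.of_isPullback sq (sq.lift_fst i 0 hw) (sq.lift_snd i 0 hw)
  have hEf := h.isFiniteFlat_of_isPullback hB hD hB' sq
  obtain ⟨a, ha⟩ := h'.exists_lift (y - x ≫ f) (by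
    rw [Preadditive.sub_comp, Category.assoc, hq, sq.w, sub_self])
  have := h'.mono
  obtain ⟨g, hg⟩ := hE.exists_desc hEf hB' (x + a ≫ i) (by
    have hneg : sq.lift i 0 hw ≫ a = -𝟙 _ := by
      rw [← cancel_mono i', Category.assoc, ha]
      simp [Preadditive.comp_sub, hi]
    simp [Preadditive.comp_add, reassoc_of% hneg])
  have := hE.epi hEf hB'
  refine ⟨g, ?_, ?_⟩
  · have hzero : sq.lift (𝟙 B) f (by simp [hq]) ≫ a = 0 := by
      rw [← cancel_mono i', Category.assoc, ha]
      simp [Preadditive.comp_sub]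
    have := sq.lift (𝟙 B) f (by simp [hq]) ≫= hg
    rw [sq.lift_snd_assoc, Preadditive.comp_add, reassoc_of% hzero, sq.lift_fst] at this
    simpa using this
  · rw [← cancel_epi y, reassoc_of% hg, Preadditive.add_comp, Category.assoc, hi, ha]
    simp

theorem isIso {i' : A' ⟶ B'} {q' : B' ⟶ D'} (h : IsShortExact i q)
    (h' : IsShortExact i' q') (hB : IsFiniteFlat B) (hB' : IsFiniteFlat B') (hD : IsFiniteFlat D)
    (f : B ⟶ B') (α : A ⟶ A') (δ : D ⟶ D') [IsIso α] [IsIso δ]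
    (hi : i ≫ f = α ≫ i') (hq : f ≫ q' = q ≫ δ) : IsIso f :=
  h.isIso_of_comp_eq (h'.comp_isIso α (inv δ)) hB hB' hD f hi (by rw [reassoc_of% hq]; simp)

end IsShortExact

attribute [local instance] hasBinaryBiproducts_of_finite_biproducts

theorem isPullback_biprod (X Y : CommGroupScheme O) :
    IsPullback (schemeMap (biprod.snd : X ⊞ Y ⟶ Y)) (schemeMap (biprod.fst : X ⊞ Y ⟶ X))
      Y.structureMap X.structureMap := by
  let T : CommGroupScheme O := CommGrp.trivial _
  have hT : IsZero T := ⟨fun Z => ⟨CommGrp.uniqueHomFromTrivial Z⟩, fun Z => ⟨⟨⟨0⟩, fun f =>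
    CommGrp.hom_ext _ _ (toUnit_unique _ _)⟩⟩⟩
  have sq : IsPullback (biprod.snd : X ⊞ Y ⟶ Y) (biprod.fst : X ⊞ Y ⟶ X) (0 : Y ⟶ T) 0 :=
    ⟨⟨hT.eq_of_tgt _ _⟩, ⟨PullbackCone.IsLimit.mk _ (fun s => biprod.lift s.snd s.fst)
      (by simp) (by simp) fun s m h₁ h₂ => biprod.hom_ext _ _ (by simp [h₂]) (by simp [h₁])⟩⟩
  have hzero (Z : CommGroupScheme O) : schemeMap (0 : Z ⟶ T) = Z.structureMap :=
    (Category.comp_id _).symm.trans (schemeMap_comp_structureMap (0 : Z ⟶ T))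
  rw [← hzero X, ← hzero Y]
  exact isPullback_schemeMap sq

theorem IsFiniteFlat.biprod (hX : IsFiniteFlat X) (hY : IsFiniteFlat Y) : IsFiniteFlat (X ⊞ Y) := by
  have := hY.finite
  have := hY.flat
  have sq := isPullback_biprod X Y
  have : IsFinite (schemeMap (biprod.fst : X ⊞ Y ⟶ X)) :=
    MorphismProperty.of_isPullback sq inferInstance
  have : Flat (schemeMap (biprod.fst : X ⊞ Y ⟶ X)) :=
    MorphismProperty.of_isPullback sq inferInstance
  exact hX.of_schemeMap biprod.fst

end CommGroupScheme

section Descent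

theorem exists_isSplitCoequalizer_of_isLimit_kernelFork {C : Type*} [Category* C] [Preadditive C]
    [HasBinaryBiproducts C] {A E S P EP EW : C} {i : A ⟶ E} {π : E ⟶ S} {w : i ≫ π = 0}
    (hk : IsLimit (KernelFork.ofι i w)) {ρ : P ⟶ E} {σ : A ⟶ P} (hσ : σ ≫ ρ = i)
    {x₁ : EP ⟶ E} {x₂ : EP ⟶ P} (hEP : IsPullback x₁ x₂ π (ρ ≫ π))
    {w₁ : EW ⟶ E} {w₂ : EW ⟶ P ⊞ A} (hEW : IsPullback w₁ w₂ π (biprod.desc (𝟙 P) σ ≫ ρ ≫ π))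
    {ef eg : EW ⟶ EP} (hf₁ : ef ≫ x₁ = w₁) (hf₂ : ef ≫ x₂ = w₂ ≫ biprod.desc (𝟙 P) σ)
    (hg₁ : eg ≫ x₁ = w₁) (hg₂ : eg ≫ x₂ = w₂ ≫ biprod.fst) :
    ∃ (y : EP ⟶ P) (c : IsSplitCoequalizer ef eg y),
      c.rightSection ≫ x₁ = ρ ∧ c.rightSection ≫ x₂ = 𝟙 P := by
  have : Mono i := ⟨fun a b hab => Fork.IsLimit.hom_ext hk hab⟩
  obtain ⟨d, hd⟩ : ∃ d, d ≫ i = x₁ - x₂ ≫ ρ :=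
    ⟨_, hk.fac (KernelFork.ofι (x₁ - x₂ ≫ ρ) (by simp [Preadditive.sub_comp, hEP.w])) .zero⟩
  let y := x₂ + d ≫ σ
  have hyρ : y ≫ ρ = x₁ := by simp [y, Preadditive.add_comp, hσ, hd]
  have hf : biprod.lift x₂ d ≫ biprod.desc (𝟙 P) σ = y := by simp [y]
  have hed : ef ≫ d = eg ≫ d - w₂ ≫ biprod.snd := by
    rw [← cancel_mono i]
    simp [Preadditive.sub_comp, hd, Preadditive.comp_sub, reassoc_of% hf₂, hf₁, hg₁,
      reassoc_of% hg₂, biprod.desc_eq, Preadditive.add_comp, Preadditive.comp_add, hσ, sub_sub]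
  have hsd : hEP.lift ρ (𝟙 P) (by simp) ≫ d = 0 := by
    rw [← cancel_mono i]
    simp [hd, Preadditive.comp_sub]
  refine ⟨y,
    { rightSection := hEP.lift ρ (𝟙 P) (by simp)
      leftSection := hEW.lift x₁ (biprod.lift x₂ d) (by rw [reassoc_of% hf, reassoc_of% hyρ])
      condition := ?_
      rightSection_π := ?_
      leftSection_bottom := hEP.hom_ext (by simp [hg₁]) (by simp [hg₂])
      leftSection_top := hEP.hom_ext (by simp [hf₁, hyρ]) (by simp [hf₂, y]) },
    hEP.lift_fst _ _ _, hEP.lift_snd _ _ _⟩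
  · simp only [y, Preadditive.comp_add, reassoc_of% hed, hf₂, hg₂, biprod.desc_eq,
      Preadditive.sub_comp, Category.comp_id, Category.assoc]
    abel
  · simp [y, Preadditive.comp_add, reassoc_of% hsd]

namespace CommGroupScheme

attribute [local instance] hasBinaryBiproducts_of_finite_biproducts

variable {O : Type u} [CommRing O] {A E S P : CommGroupScheme O} {i : A ⟶ E} {π : E ⟶ S}
  {ρ : P ⟶ E} {σ : A ⟶ P}

theorem IsShortExact.exists_isPullback_scheme (h : IsShortExact i π) (hA : IsFiniteFlat A)
    (hE : IsFiniteFlat E) (hS : IsFiniteFlat S) (hP : IsFiniteFlat P) (hσ : σ ≫ ρ = i) :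
    ∃ (Q : Scheme) (p : P.X.left ⟶ Q) (s : Q ⟶ S.X.left), IsAffine Q ∧
      schemeMap (biprod.desc (𝟙 P) σ) ≫ p = schemeMap biprod.fst ≫ p ∧
      IsPullback (schemeMap ρ) p (schemeMap π) s := by
  obtain ⟨hk⟩ := h.isKernel
  have hσπ : σ ≫ ρ ≫ π = 0 := by rw [reassoc_of% hσ, h.comp_eq_zero]
  have hinv : biprod.desc (𝟙 P) σ ≫ ρ ≫ π = biprod.fst ≫ ρ ≫ π := by
    simp [biprod.desc_eq, Preadditive.add_comp, hσπ]
  have hEP := IsPullback.of_hasPullback π (ρ ≫ π)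
  obtain ⟨EW, w₁, w₂, hEW⟩ : ∃ EW w₁ w₂, IsPullback (P := EW) w₁ w₂ π _ :=
    ⟨_, _, _, .of_hasPullback π (biprod.desc (𝟙 P) σ ≫ ρ ≫ π)⟩
  let ef := hEP.lift w₁ (w₂ ≫ biprod.desc (𝟙 P) σ) (by simp [hEW.w])
  let eg := hEP.lift w₁ (w₂ ≫ biprod.fst) (by simp [hEW.w, hinv])
  have hf₁ : ef ≫ _ = _ := hEP.lift_fst _ _ _
  have hf₂ : ef ≫ _ = _ := hEP.lift_snd _ _ _
  have hg₁ : eg ≫ _ = _ := hEP.lift_fst _ _ _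
  have hg₂ : eg ≫ _ = _ := hEP.lift_snd _ _ _
  obtain ⟨y, c, hc₁, hc₂⟩ :=
    exists_isSplitCoequalizer_of_isLimit_kernelFork hk hσ hEP hEW hf₁ hf₂ hg₁ hg₂
  have := hP.isAffine
  have := hE.isAffine
  have := hS.isAffine
  have := (hP.biprod hA).isAffine
  have := h.flat
  obtain ⟨Q, p, s, hQ, hp, sq⟩ := exists_isPullback_of_isSplitCoequalizer
    (congrArg schemeMap hinv) (isPullback_schemeMap hEP) (isPullback_schemeMap hEW)
    (congrArg schemeMap hf₁) (congrArg schemeMap hf₂) (congrArg schemeMap hg₁)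
    (congrArg schemeMap hg₂) (c.map (toScheme O)) (congrArg schemeMap hc₂)
  have hsq : schemeMap c.rightSection ≫ schemeMap _ = schemeMap ρ := congrArg schemeMap hc₁
  exact ⟨Q, p, s, hQ, hp, hsq ▸ sq⟩

open scoped CategoryTheory.MonObj in
theorem mul_comp_of_biprod_desc_comp {Q Z : Over (Spec (CommRingCat.of O))} {p : P.X ⟶ Q}
    (h : (biprod.desc (𝟙 P) σ).hom.hom.hom ≫ p = (biprod.fst : P ⊞ A ⟶ P).hom.hom.hom ≫ p)
    (g : Z ⟶ P.X) (a : Z ⟶ A.X) : (g * a ≫ σ.hom.hom.hom) ≫ p = g ≫ p := by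
  let z : Z ⟶ (P ⊞ A).X := g ≫ (biprod.inl : P ⟶ P ⊞ A).hom.hom.hom *
    a ≫ (biprod.inr : A ⟶ P ⊞ A).hom.hom.hom
  have hz (f : P ⊞ A ⟶ P) : z ≫ f.hom.hom.hom =
      g ≫ (biprod.inl ≫ f).hom.hom.hom * a ≫ (biprod.inr ≫ f).hom.hom.hom := by
    rw [MonObj.mul_comp, Category.assoc, Category.assoc]; rfl
  have hdesc : z ≫ (biprod.desc (𝟙 P) σ).hom.hom.hom = g * a ≫ σ.hom.hom.hom := by
    rw [hz, biprod.inl_desc, biprod.inr_desc]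
    exact congrArg (· * _) (Category.comp_id g)
  have hfst : z ≫ (biprod.fst : P ⊞ A ⟶ P).hom.hom.hom = g := by
    rw [hz, biprod.inl_fst, biprod.inr_fst, commGrp_hom_zero, MonObj.comp_one, mul_one]
    exact Category.comp_id g
  rw [← hdesc, Category.assoc, h, ← Category.assoc, hfst]

open scoped CategoryTheory.MonObj in
theorem IsShortExact.exists_eq_mul_of_isPullback (h : IsShortExact i π) (hσ : σ ≫ ρ = i)
    {Q Z : Over (Spec (CommRingCat.of O))} {p : P.X ⟶ Q} {s : Q ⟶ S.X}
    (hp : (biprod.desc (𝟙 P) σ).hom.hom.hom ≫ p = (biprod.fst : P ⊞ A ⟶ P).hom.hom.hom ≫ p)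
    (sq : IsPullback (schemeMap ρ) p.left (schemeMap π) s.left) {g₁ g₂ : Z ⟶ P.X}
    (hg : g₁ ≫ p = g₂ ≫ p) : ∃ a : Z ⟶ A.X, g₁ = g₂ * a ≫ σ.hom.hom.hom := by
  have hw : ρ.hom.hom.hom ≫ π.hom.hom.hom = p ≫ s := Over.OverMorphism.ext sq.w
  obtain ⟨a, ha⟩ := h.exists_eq_mul (g₁ := g₁ ≫ ρ.hom.hom.hom) (g₂ := g₂ ≫ ρ.hom.hom.hom) (by
    rw [Category.assoc, Category.assoc, hw, reassoc_of% hg])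
  have hσ' : σ.hom.hom.hom ≫ ρ.hom.hom.hom = i.hom.hom.hom := congrArg (·.hom.hom.hom) hσ
  have hρ : g₁ ≫ ρ.hom.hom.hom = (g₂ * a ≫ σ.hom.hom.hom) ≫ ρ.hom.hom.hom := by
    rw [ha, MonObj.mul_comp, Category.assoc, hσ']
  have hp' : g₁ ≫ p = (g₂ * a ≫ σ.hom.hom.hom) ≫ p := by
    rw [hg, mul_comp_of_biprod_desc_comp hp]
  exact ⟨a, Over.OverMorphism.ext (sq.hom_ext (congrArg CommaMorphism.left hρ)
    (congrArg CommaMorphism.left hp'))⟩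

open scoped CategoryTheory.MonObj in
theorem IsShortExact.exists_isPullback (h : IsShortExact i π) (hA : IsFiniteFlat A)
    (hE : IsFiniteFlat E) (hS : IsFiniteFlat S) (hP : IsFiniteFlat P) (hσ : σ ≫ ρ = i) :
    ∃ (P' : CommGroupScheme O) (p : P ⟶ P') (s : P' ⟶ S), IsAffine P'.X.left ∧
      IsPullback ρ p π s ∧ σ ≫ p = 0 := by
  obtain ⟨Q₀, p₀, s₀, hQ, hinv, sq⟩ := h.exists_isPullback_scheme hA hE hS hP hσ
  let Q : Over (Spec (CommRingCat.of O)) := Over.mk (s₀ ≫ S.structureMap)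
  let p : P.X ⟶ Q := Over.homMk p₀ (by
    change p₀ ≫ s₀ ≫ S.structureMap = P.structureMap
    rw [← sq.w_assoc, schemeMap_comp_structureMap, schemeMap_comp_structureMap])
  let s : Q ⟶ S.X := Over.homMk s₀ rfl
  have hp : (biprod.desc (𝟙 P) σ).hom.hom.hom ≫ p =
      (biprod.fst : P ⊞ A ⟶ P).hom.hom.hom ≫ p := Over.OverMorphism.ext hinv
  have hmul {Z} (g : Z ⟶ P.X) (a : Z ⟶ A.X) := mul_comp_of_biprod_desc_comp hp g a
  have hex {Z} {g₁ g₂ : Z ⟶ P.X} (hg : g₁ ≫ p = g₂ ≫ p) :=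
    h.exists_eq_mul_of_isPullback hσ (s := s) hp sq hg
  have hcov : fpqc p.left := MorphismProperty.of_isPullback (P := fpqc) sq (h.fpqc_schemeMap hE hS)
  have := hcov.effectiveEpi_over
  have := (hcov.tensorHom hcov).effectiveEpi_over
  have := ((hcov.tensorHom hcov).tensorHom hcov).effectiveEpi_over
  obtain ⟨_, _, _⟩ := exists_grpObj_of_effectiveEpi p
    (fun _ _ _ _ hg hh => by
      obtain ⟨a, rfl⟩ := hex hg
      obtain ⟨b, rfl⟩ := hex hh
      rw [mul_mul_mul_comm, ← MonObj.mul_comp, hmul])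
    (fun _ _ hg => by
      obtain ⟨a, rfl⟩ := hex hg
      rw [mul_inv, ← GrpObj.inv_comp, hmul])
  have hw : ρ.hom.hom.hom ≫ π.hom.hom.hom = p ≫ s := Over.OverMorphism.ext sq.w
  have : IsMonHom (p ≫ s) := by rw [← hw]; infer_instance
  have : IsMonHom s := isMonHom_of_epi_comp p s
  let P' : CommGroupScheme O := { X := Q }
  let pG : P ⟶ P' := InducedCategory.homMk (Grp.homMk p)
  let sG : P' ⟶ S := InducedCategory.homMk (Grp.homMk s)
  have : ReflectsLimit (cospan π sG) (toScheme O) := reflectsLimit_of_reflectsIsomorphisms _ _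
  refine ⟨P', pG, sG, hQ, IsPullback.of_map (toScheme O) (CommGrp.hom_ext _ _ hw) sq,
    CommGrp.hom_ext _ _ ?_⟩
  have hσp : σ.hom.hom.hom ≫ p = 1 ≫ p := by simpa using hmul (1 : A.X ⟶ P.X) (𝟙 A.X)
  rw [commGrp_hom_zero]
  exact hσp.trans (MonObj.one_comp (f := pG.hom.hom.hom))

theorem IsShortExact.exists_descent (h : IsShortExact i π) (hA : IsFiniteFlat A)
    (hE : IsFiniteFlat E) (hS : IsFiniteFlat S) (hP : IsFiniteFlat P) [Flat (schemeMap ρ)]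
    [Surjective (schemeMap ρ)] (hσ : σ ≫ ρ = i) :
    ∃ (P' : CommGroupScheme O) (p : P ⟶ P') (s : P' ⟶ S), IsFiniteFlat P' ∧
      IsPullback ρ p π s ∧ IsShortExact σ p ∧ Flat (schemeMap s) ∧ Surjective (schemeMap s) := by
  obtain ⟨P', p, s, _, sq, hσp⟩ := h.exists_isPullback hA hE hS hP hσ
  have hπ := h.fpqc_schemeMap hE hS
  have sq' := isPullback_schemeMap sq
  have := hS.isAffine
  have := hP.isFinite_schemeMap hE ρ
  have : IsFinite (schemeMap s) := hπ.isFinite_of_isPullback sq'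
  have : Flat (schemeMap s) := MorphismProperty.of_isPullback_of_descendsAlong
    (P := @Flat) (Q := fpqc) sq' hπ inferInstance
  have : Surjective (schemeMap s) := MorphismProperty.of_isPullback_of_descendsAlong
    (P := @Surjective) (Q := fpqc) sq' hπ inferInstance
  exact ⟨P', p, s, hS.of_schemeMap s, sq, h.of_isPullback sq hσ hσp, inferInstance, inferInstance⟩

end CommGroupScheme

end Descent

namespace CommGroupScheme

attribute [local instance] hasBinaryBiproducts_of_finite_biproducts

variable {O : Type u} [CommRing O] {A B D K P S U V X Y Z : CommGroupScheme O}

theorem surjective_structureMap (X : CommGroupScheme O) : Surjective X.structureMap := by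
  let T : CommGroupScheme O := CommGrp.trivial _
  have h : schemeMap (0 : T ⟶ X) ≫ X.structureMap = T.structureMap := schemeMap_comp_structureMap _
  have hT : Surjective T.structureMap := inferInstanceAs (Surjective (𝟙 _))
  rw [← h] at hT
  exact .of_comp (schemeMap (0 : T ⟶ X)) X.structureMap

theorem isShortExact_biprod (hX : IsFiniteFlat X) :
    IsShortExact (biprod.inl : X ⟶ X ⊞ Y) (biprod.snd : X ⊞ Y ⟶ Y) := by
  have sq := (isPullback_biprod X Y).flip
  have := hX.flat
  have := X.surjective_structureMap
  exact ⟨biprod.inl_snd, nonempty_isLimit_kernelFork _ fun z hz =>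
    ⟨z ≫ biprod.fst, biprod.hom_ext _ _ (by simp) (by simp [hz])⟩,
    MorphismProperty.of_isPullback sq inferInstance,
    MorphismProperty.of_isPullback sq inferInstance⟩

section Order

theorem HasOrder.ne_zero [Nontrivial O] {m : ℕ} (hm : HasOrder X m) (hX : IsFiniteFlat X) :
    m ≠ 0 := by
  have := hX.finite
  have := hX.flat
  have hpos : 1 ≤ X.structureMap.finrank :=
    (Scheme.Hom.one_le_finrank_iff_surjective _).2 X.surjective_structureMap
  obtain ⟨s⟩ : Nonempty (Spec (CommRingCat.of O)) := inferInstance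
  have hs := hpos s
  rw [hm s] at hs
  exact Nat.one_le_iff_ne_zero.1 hs

theorem IsFiniteFlat.exists_hasOrder [IsDomain O] (hX : IsFiniteFlat X) : ∃ m, HasOrder X m := by
  have := hX.isAffine
  have := hX.finite
  have := hX.flat
  exact ⟨_, finrank_eq_finrank_appTop X.structureMap⟩

theorem isFinite_flat_finrank_biprod_fst (hY : IsFiniteFlat Y) {d : ℕ} (hd : HasOrder Y d) :
    IsFinite (schemeMap (biprod.fst : X ⊞ Y ⟶ X)) ∧ Flat (schemeMap (biprod.fst : X ⊞ Y ⟶ X)) ∧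
      ∀ x, (schemeMap (biprod.fst : X ⊞ Y ⟶ X)).finrank x = d := by
  have := hY.finite
  have := hY.flat
  have sq := isPullback_biprod X Y
  refine ⟨MorphismProperty.of_isPullback sq inferInstance,
    MorphismProperty.of_isPullback sq inferInstance, fun x => ?_⟩
  rw [Scheme.Hom.finrank_of_isPullback _ _ _ _ sq, hd]

variable {i : K ⟶ A} {f : A ⟶ B} {w : i ≫ f = 0}

theorem isPullback_biprod_of_isLimit_kernelFork (hk : IsLimit (KernelFork.ofι i w)) :
    IsPullback (biprod.fst : A ⊞ K ⟶ A) (biprod.desc (𝟙 A) i) f f := by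
  have : Mono i := ⟨fun a b hab => Fork.IsLimit.hom_ext hk hab⟩
  have hdiff (s : PullbackCone f f) : (s.snd - s.fst) ≫ f = 0 := by
    rw [Preadditive.sub_comp, s.condition, sub_self]
  have hlift (s : PullbackCone f f) :
      hk.lift (KernelFork.ofι _ (hdiff s)) ≫ i = s.snd - s.fst := hk.fac _ .zero
  refine ⟨⟨by simp [biprod.desc_eq, Preadditive.add_comp, w]⟩, ⟨PullbackCone.IsLimit.mk _
    (fun s => biprod.lift s.fst (hk.lift (KernelFork.ofι _ (hdiff s)))) (by simp)
    (by simp [hlift]) fun s m h₁ h₂ => biprod.hom_ext _ _ (by simp [h₁]) ?_⟩⟩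
  rw [biprod.lift_snd, ← cancel_mono i, hlift, ← h₂, ← h₁]
  simp [biprod.desc_eq, Preadditive.comp_add]

theorem isShortExact_of_appTop_injective (hk : IsLimit (KernelFork.ofι i w)) (hK : IsFiniteFlat K)
    (hA : IsFiniteFlat A) (hB : IsFiniteFlat B) {d : ℕ} (hd : HasOrder K d)
    (hf : Function.Injective (schemeMap f).appTop.hom) : IsShortExact i f := by
  have := hA.isAffine
  have := hB.isAffine
  have := hA.isFinite_schemeMap hB f
  obtain ⟨_, _, hrank⟩ := isFinite_flat_finrank_biprod_fst (X := A) hK hd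
  have sq := isPullback_schemeMap (isPullback_biprod_of_isLimit_kernelFork hk)
  exact ⟨w, ⟨hk⟩, flat_of_isPullback_of_finrank_eq sq hf hrank,
    surjective_of_injective_appTop _ hf⟩

theorem appTop_injective_of_hasOrder_mul [IsDomain O] (hk : IsLimit (KernelFork.ofι i w))
    (hK : IsFiniteFlat K) (hA : IsFiniteFlat A) (hB : IsFiniteFlat B) {d m : ℕ}
    (hd : HasOrder K d) (hm : HasOrder B m) (hdm : HasOrder A (d * m)) :
    Function.Injective (schemeMap f).appTop.hom := by
  have := hA.isAffine
  have := hB.isAffine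
  have := hB.finite
  have := hB.flat
  have hstr : schemeMap f ≫ B.structureMap = A.structureMap := schemeMap_comp_structureMap f
  have : IsFinite (schemeMap f ≫ B.structureMap) := hstr ▸ hA.finite
  have : Flat (schemeMap f ≫ B.structureMap) := hstr ▸ hA.flat
  obtain ⟨_, _, hrank⟩ := isFinite_flat_finrank_biprod_fst (X := A) hK hd
  refine appTop_injective_of_isPullback (b := B.structureMap)
    (isPullback_schemeMap (isPullback_biprod_of_isLimit_kernelFork hk)) (hd.ne_zero hK) hrank
    fun s => ?_
  rw [hstr, hm, hdm]

theorem appTop_injective_of_fpqc (hf : fpqc (schemeMap f)) (hA : IsFiniteFlat A)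
    (hB : IsFiniteFlat B) : Function.Injective (schemeMap f).appTop.hom := by
  have := hA.isAffine
  have := hB.isAffine
  obtain ⟨⟨_, _⟩, _⟩ := hf
  exact ((Flat.flat_and_surjective_iff_faithfullyFlat_of_isAffine (schemeMap f)).1
    ⟨inferInstance, inferInstance⟩).injective

end Order

section Extension

/-- The standing closure properties of a full subcategory of finite flat group schemes: it is closed
under products, closed flat subgroup schemes and quotients by these. -/
structure IsSubquotientClosed (𝒞 : ObjectProperty (CommGroupScheme O)) : Prop where
  isFiniteFlat : ∀ {X}, 𝒞 X → IsFiniteFlat X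
  prod : ∀ {X Y}, 𝒞 X → 𝒞 Y → 𝒞 (X ⨯ Y)
  sub : ∀ {X Y} (i : X ⟶ Y), IsClosedFlatSubgroup i → 𝒞 Y → 𝒞 X
  quot : ∀ {X Y Z} (i : X ⟶ Y) (q : Y ⟶ Z), IsClosedFlatSubgroup i → IsFiniteFlat Z →
    IsShortExact i q → 𝒞 Y → 𝒞 Z

theorem IsShortExact.comp_of_isPullback {ν : S ⟶ P} {ρ : P ⟶ B} (h : IsShortExact ν ρ)
    {p : P ⟶ Z} {π : B ⟶ D} {s : Z ⟶ D} (sq : IsPullback ρ p π s) [Flat (schemeMap s)]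
    [Surjective (schemeMap s)] : IsShortExact (ν ≫ p) s := by
  have := h.mono
  have w : (ν ≫ p) ≫ s = 0 := by
    rw [Category.assoc, ← sq.w, reassoc_of% h.comp_eq_zero, zero_comp]
  have : Mono (ν ≫ p) := ⟨fun x y hxy => by
    rw [← cancel_mono ν]
    exact sq.hom_ext (by simp [h.comp_eq_zero]) (by simpa using hxy)⟩
  refine ⟨w, nonempty_isLimit_kernelFork w fun z hz => ?_, inferInstance, inferInstance⟩
  obtain ⟨a, ha⟩ := h.exists_lift (sq.lift 0 z (by simp [hz])) (sq.lift_fst _ _ _)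
  exact ⟨a, by rw [← Category.assoc, ha, sq.lift_snd]⟩

namespace IsSubquotientClosed

variable {𝒞 : ObjectProperty (CommGroupScheme O)} (h𝒞 : IsSubquotientClosed 𝒞)
include h𝒞

theorem of_mono (hY : 𝒞 Y) (hX : IsFiniteFlat X) (i : X ⟶ Y) [Mono i] : 𝒞 X :=
  h𝒞.sub i (hX.isClosedFlatSubgroup (h𝒞.isFiniteFlat hY) i) hY

theorem biprod (hX : 𝒞 X) (hY : 𝒞 Y) : 𝒞 (X ⊞ Y) :=
  h𝒞.of_mono (h𝒞.prod hX hY) ((h𝒞.isFiniteFlat hX).biprod (h𝒞.isFiniteFlat hY))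
    (biprod.isoProd X Y).hom

theorem of_isPullback {κ : S ⟶ U} {ψ : U ⟶ V} (h : IsShortExact κ ψ) (hU : 𝒞 U) (hV : 𝒞 V)
    (hX : 𝒞 X) {b : P ⟶ U} {ρ : P ⟶ X} {g : X ⟶ V} (sq : IsPullback b ρ ψ g) : 𝒞 P :=
  have : Mono (biprod.lift b ρ) := ⟨fun x y hxy => sq.hom_ext
    (by simpa using hxy =≫ biprod.fst) (by simpa using hxy =≫ biprod.snd)⟩
  h𝒞.of_mono (h𝒞.biprod hU hX) (h.isFiniteFlat_of_isPullback (h𝒞.isFiniteFlat hU)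
    (h𝒞.isFiniteFlat hV) (h𝒞.isFiniteFlat hX) sq) (biprod.lift b ρ)

-- The pullback `P` of `ψ` along `g` is an extension of `X` by `S`, and `σ = (φ, i) : A ⟶ P` is a
-- splitting of it over `A`, so `P / A` is an extension of `D` by `S`. If `P / A ⟶ U` extends `κ`,
-- it agrees with the projection `P ⟶ U` on `S`, and the difference of the two descends to `X`.
theorem exists_extension {i : A ⟶ X} {π : X ⟶ D} {κ : S ⟶ U} {ψ : U ⟶ V}
    (h₁ : IsShortExact i π) (h₂ : IsShortExact κ ψ) (hA : 𝒞 A) (hX : 𝒞 X) (hD : 𝒞 D) (hU : 𝒞 U)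
    (hV : 𝒞 V) {φ : A ⟶ U} {g : X ⟶ V} (hg : i ≫ g = φ ≫ ψ)
    (hS : ∀ {P : CommGroupScheme O} (κ' : S ⟶ P) (q : P ⟶ D), 𝒞 P → IsShortExact κ' q →
      ∃ d : P ⟶ U, κ' ≫ d = κ) :
    ∃ f : X ⟶ U, i ≫ f = φ := by
  have hAf := h𝒞.isFiniteFlat hA
  have hXf := h𝒞.isFiniteFlat hX
  have sq := IsPullback.of_hasPullback ψ g
  have hP := h𝒞.of_isPullback h₂ hU hV hX sq
  have hPf := h𝒞.isFiniteFlat hP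
  let ν := sq.lift κ 0 (by simp [h₂.comp_eq_zero])
  have hPX : IsShortExact ν (pullback.snd ψ g) :=
    h₂.of_isPullback sq (sq.lift_fst _ _ _) (sq.lift_snd _ _ _)
  have := hPX.flat
  have := hPX.surjective
  let σ := sq.lift φ i hg.symm
  have hσ : σ ≫ pullback.snd ψ g = i := sq.lift_snd _ _ _
  obtain ⟨P', p, s, hP'f, sq', hσp, _, _⟩ :=
    h₁.exists_descent hAf hXf (h𝒞.isFiniteFlat hD) hPf hσ
  have := hσp.mono
  have hP' : 𝒞 P' := h𝒞.quot σ p (hAf.isClosedFlatSubgroup hPf σ) hP'f hσp hP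
  obtain ⟨d, hd⟩ := hS _ _ hP' (hPX.comp_of_isPullback sq')
  obtain ⟨f, hf⟩ := hPX.exists_desc hPf hXf (pullback.fst ψ g - p ≫ d) (by
    rw [Preadditive.comp_sub, sub_eq_zero, ← Category.assoc, hd, sq.lift_fst])
  refine ⟨f, ?_⟩
  rw [← hσ, Category.assoc, hf, Preadditive.comp_sub, sq.lift_fst, reassoc_of% hσp.comp_eq_zero,
    zero_comp, sub_zero]

theorem exists_retraction [Subsingleton (ExtIn 𝒞 A B)] (hA : 𝒞 A) (hB : 𝒞 B)
    (hX : 𝒞 X) {i : B ⟶ X} {q : X ⟶ A} (h : IsShortExact i q) : ∃ d : X ⟶ B, i ≫ d = 𝟙 B := by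
  let E₁ : Extension 𝒞 A B := ⟨X, hX, i, q, h⟩
  let E₂ : Extension 𝒞 A B :=
    ⟨B ⊞ A, h𝒞.biprod hB hA, biprod.inl, biprod.snd, isShortExact_biprod (h𝒞.isFiniteFlat hB)⟩
  obtain ⟨φ, hφ, -⟩ := Quotient.exact
    (Subsingleton.elim (α := ExtIn 𝒞 A B) (Quotient.mk _ E₁) (Quotient.mk _ E₂))
  exact ⟨φ.hom ≫ biprod.fst, by rw [reassoc_of% hφ]; exact biprod.inl_fst⟩

end IsSubquotientClosed

end Extension

end CommGroupScheme

/-! ### Towers and `p`-divisible groups -/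

/-- A sequence of group schemes with transition maps in both directions, such as the `G[ϖⁿ]` of a
`p`-divisible group `G` with the inclusions and multiplication by `ϖ`. -/
structure CommGroupScheme.Tower (O : Type u) [CommRing O] where
  obj : ℕ → CommGroupScheme O
  incl (n : ℕ) : obj n ⟶ obj (n + 1)
  proj (n : ℕ) : obj (n + 1) ⟶ obj n
  comm (n : ℕ) : incl (n + 1) ≫ proj (n + 1) = proj n ≫ incl n

namespace CommGroupScheme.Tower

variable {O : Type u} [CommRing O] (t : Tower O)

/-- The composite of the inclusions from `obj 1` to `obj (n + 1)`. -/
noncomputable def fromOne : (n : ℕ) → (t.obj 1 ⟶ t.obj (n + 1))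
  | 0 => 𝟙 _
  | n + 1 => fromOne n ≫ t.incl (n + 1)

/-- The composite of the projections from `obj (n + 1)` to `obj 1`. -/
noncomputable def toOne : (n : ℕ) → (t.obj (n + 1) ⟶ t.obj 1)
  | 0 => 𝟙 _
  | n + 1 => t.proj (n + 1) ≫ toOne n

theorem toOne_zero : t.toOne 0 = 𝟙 _ := rfl
theorem fromOne_succ (n : ℕ) : t.fromOne (n + 1) = t.fromOne n ≫ t.incl (n + 1) := rfl
theorem toOne_succ (n : ℕ) : t.toOne (n + 1) = t.proj (n + 1) ≫ t.toOne n := rfl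

/-- Exactness of a tower: `obj m` behaves like the kernel of `ϖᵐ` on a group scheme on which `ϖ` is
surjective, and the two transition maps like the inclusions and multiplication by `ϖ`. -/
structure IsExact : Prop where
  isZero : IsZero (t.obj 0)
  isShortExact_proj (n : ℕ) : IsShortExact (t.fromOne n) (t.proj n)
  isShortExact_incl (n : ℕ) : IsShortExact (t.incl n) (t.toOne n)

/-- An endomorphism of a tower. -/
structure Endo where
  app (n : ℕ) : t.obj n ⟶ t.obj n
  incl_app (n : ℕ) : t.incl n ≫ app (n + 1) = app n ≫ t.incl n
  app_proj (n : ℕ) : app (n + 1) ≫ t.proj n = t.proj n ≫ app n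

variable {t}

theorem fromOne_proj (hz : IsZero (t.obj 0)) : ∀ n : ℕ, t.fromOne n ≫ t.proj n = 0
  | 0 => hz.eq_of_tgt _ _
  | n + 1 => by
    rw [fromOne_succ, Category.assoc, t.comm, reassoc_of% fromOne_proj hz n, zero_comp]

theorem incl_toOne (hz : IsZero (t.obj 0)) : ∀ n : ℕ, t.incl n ≫ t.toOne n = 0
  | 0 => hz.eq_of_src _ _
  | n + 1 => by
    rw [toOne_succ, ← Category.assoc, t.comm, Category.assoc, incl_toOne hz n, comp_zero]

instance mono_fromOne [∀ n, Mono (t.incl n)] : ∀ n : ℕ, Mono (t.fromOne n)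
  | 0 => inferInstanceAs (Mono (𝟙 _))
  | n + 1 =>
    have := mono_fromOne n
    inferInstanceAs (Mono (t.fromOne n ≫ t.incl (n + 1)))

theorem exists_lift_fromOne [∀ n, Mono (t.incl n)]
    (hlift : ∀ (n : ℕ) {Z : CommGroupScheme O} (z : Z ⟶ t.obj (n + 2)),
      z ≫ t.proj (n + 1) = 0 → ∃ a, a ≫ t.incl (n + 1) = z) {Z : CommGroupScheme O} :
    ∀ {n : ℕ} (z : Z ⟶ t.obj (n + 1)), z ≫ t.proj n = 0 → ∃ a, a ≫ t.fromOne n = z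
  | 0, z, _ => ⟨z, Category.comp_id _⟩
  | n + 1, z, hz => by
    obtain ⟨b, rfl⟩ := hlift n z hz
    have hb : b ≫ t.proj n = 0 := by
      rw [← cancel_mono (t.incl n), Category.assoc, ← t.comm, ← Category.assoc, hz, zero_comp]
    obtain ⟨a, rfl⟩ := exists_lift_fromOne hlift b hb
    exact ⟨a, (Category.assoc _ _ _).symm⟩

theorem fpqc_toOne (h : ∀ n, fpqc (schemeMap (t.proj n))) : ∀ n, fpqc (schemeMap (t.toOne n))
  | 0 => ⟨⟨inferInstanceAs (Surjective (𝟙 _)), inferInstanceAs (Flat (𝟙 _))⟩,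
      inferInstanceAs (QuasiCompact (𝟙 _))⟩
  | n + 1 => MorphismProperty.comp_mem fpqc _ _ (h (n + 1)) (fpqc_toOne h n)

theorem Endo.app_toOne (c : t.Endo) : ∀ n : ℕ, c.app (n + 1) ≫ t.toOne n = t.toOne n ≫ c.app 1
  | 0 => (Category.comp_id _).trans (Category.id_comp _).symm
  | n + 1 => by
    rw [toOne_succ, ← Category.assoc, c.app_proj, Category.assoc, app_toOne c n, Category.assoc]

theorem isIso_of_ne_zero
    (hend : ∀ f₀ f : t.obj 1 ⟶ t.obj 1, f₀ ≠ 0 → ∃ c : t.Endo, f₀ ≫ c.app 1 = f)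
    {f : t.obj 1 ⟶ t.obj 1} (hf : f ≠ 0) : IsIso f := by
  obtain ⟨c, hc⟩ := hend f (𝟙 _) hf
  have hc0 : c.app 1 ≠ 0 := by
    intro h
    rw [h, comp_zero] at hc
    exact hf (by rw [← Category.comp_id f, ← hc, comp_zero])
  obtain ⟨d, hd⟩ := hend (c.app 1) (𝟙 _) hc0
  have hfd : f = d.app 1 := by rw [← Category.comp_id f, ← hd, reassoc_of% hc]
  exact ⟨c.app 1, hc, hfd ▸ hd⟩

theorem exists_proj {m n : ℕ} (hmn : m ≤ n) :
    ∃ (a : t.obj n ⟶ t.obj m) (b : t.obj (n + 1) ⟶ t.obj (m + 1)),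
      t.incl n ≫ b = a ≫ t.incl m ∧ b ≫ t.toOne m = t.toOne n := by
  induction n, hmn using Nat.le_induction with
  | base => exact ⟨𝟙 _, 𝟙 _, by simp, by simp⟩
  | succ n _ ih =>
    obtain ⟨a, b, h₁, h₂⟩ := ih
    refine ⟨t.proj n ≫ a, t.proj (n + 1) ≫ b, ?_, ?_⟩
    · rw [← Category.assoc, t.comm, Category.assoc, h₁, Category.assoc]
    · rw [Category.assoc, h₂, toOne_succ]

theorem exists_incl_comp_eq_fromOne :
    ∀ n : ℕ, ∃ a : t.obj 2 ⟶ t.obj (n + 2), t.incl 1 ≫ a = t.fromOne (n + 1)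
  | 0 => ⟨𝟙 _, (Category.comp_id _).trans (Category.id_comp _).symm⟩
  | n + 1 => by
    obtain ⟨a, ha⟩ := exists_incl_comp_eq_fromOne n
    exact ⟨a ≫ t.incl (n + 2), by rw [reassoc_of% ha, t.fromOne_succ (n + 1)]⟩

end CommGroupScheme.Tower

namespace PDivisibleGroup

variable {p : ℕ} {O : Type u} [CommRing O]

section Level

variable (G : PDivisibleGroup p O) {Z : CommGroupScheme O}

instance mono_incl (n : ℕ) : Mono (G.incl n) :=
  ⟨fun _ _ h => Fork.IsLimit.hom_ext (G.isKernel n).some h⟩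

theorem exists_lift_incl {n : ℕ} (z : Z ⟶ G.level (n + 1)) (hz : (p ^ n : ℕ) • z = 0) :
    ∃ a, a ≫ G.incl n = z := by
  have h : z ≫ ((p ^ n : ℕ) • 𝟙 (G.level (n + 1))) = 0 := by
    rw [Preadditive.comp_nsmul, Category.comp_id, hz]
  exact ⟨(G.isKernel n).some.lift (KernelFork.ofι z h),
    (G.isKernel n).some.fac (KernelFork.ofι z h) .zero⟩

theorem pow_smul_eq_zero {n : ℕ} (z : Z ⟶ G.level n) : (p ^ n : ℕ) • z = 0 := by
  have h := G.incl_pow n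
  rw [Preadditive.comp_nsmul, Category.comp_id] at h
  rw [← cancel_mono (G.incl n), Preadditive.nsmul_comp, ← Preadditive.comp_nsmul, h, comp_zero,
    zero_comp]

theorem isZero_level_zero : IsZero (G.level 0) := by
  rw [IsZero.iff_id_eq_zero, ← one_smul ℕ (𝟙 (G.level 0)), ← pow_zero p, pow_smul_eq_zero]

theorem exists_mul (n : ℕ) : ∃ m : G.level (n + 1) ⟶ G.level n, m ≫ G.incl n = p • 𝟙 _ :=
  G.exists_lift_incl _ (by rw [← mul_smul, ← pow_succ, pow_smul_eq_zero])

/-- Multiplication by `p`, as a map from level `n + 1` to level `n`. -/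
noncomputable def mul (n : ℕ) : G.level (n + 1) ⟶ G.level n := (G.exists_mul n).choose

theorem mul_incl (n : ℕ) : G.mul n ≫ G.incl n = p • 𝟙 _ := (G.exists_mul n).choose_spec

/-- The tower of the levels `G[pⁿ]`, with multiplication by `p` as projections. -/
noncomputable abbrev levelTower : Tower O where
  obj := G.level
  incl := G.incl
  proj := G.mul
  comm n := by
    rw [← cancel_mono (G.incl (n + 1)), Category.assoc, mul_incl, mul_incl,
      Preadditive.comp_nsmul, Category.comp_id, Preadditive.nsmul_comp, Category.id_comp]

theorem isShortExact_mul [IsDomain O] (n : ℕ) :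
    IsShortExact (G.levelTower.fromOne n) (G.mul n) := by
  have : ∀ n, Mono (G.levelTower.incl n) := G.mono_incl
  have hlift (n : ℕ) {Z : CommGroupScheme O} (z : Z ⟶ G.level (n + 2))
      (hz : z ≫ G.mul (n + 1) = 0) : ∃ a, a ≫ G.incl (n + 1) = z := by
    have hpz : p • z = 0 := by
      rw [← Category.comp_id z, ← Preadditive.comp_nsmul, ← mul_incl, reassoc_of% hz, zero_comp]
    exact G.exists_lift_incl z (by rw [pow_succ, mul_smul, hpz, smul_zero])
  obtain ⟨hk⟩ := nonempty_isLimit_kernelFork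
    (Tower.fromOne_proj (t := G.levelTower) G.isZero_level_zero n)
    (Tower.exists_lift_fromOne hlift)
  have hd : HasOrder (G.level 1) (p ^ G.height) := by simpa only [one_mul] using G.hasOrder 1
  have hdn : HasOrder (G.level (n + 1)) (p ^ G.height * p ^ (n * G.height)) := by
    rw [← pow_add, add_comm G.height, ← Nat.succ_mul]
    exact G.hasOrder (n + 1)
  exact isShortExact_of_appTop_injective hk (G.isFiniteFlat 1) (G.isFiniteFlat _)
    (G.isFiniteFlat n) hd (appTop_injective_of_hasOrder_mul hk (G.isFiniteFlat 1)
      (G.isFiniteFlat _) (G.isFiniteFlat n) hd (G.hasOrder n) hdn)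

end Level

section Torsion

variable {G : PDivisibleGroup p O} {R : Type w} [CommRing R] (e : R ≃+* End G)
  {Z : CommGroupScheme O}

theorem app_mul (r s : R) (n : ℕ) : app (e (r * s)) n = app (e r) n ≫ app (e s) n := by
  rw [mul_comm, map_mul, End.mul_def, comp_app]

theorem app_natCast (m n : ℕ) : app (e (m : R)) n = m • 𝟙 (G.level n) := by
  rw [map_natCast]
  induction m with
  | zero => rw [Nat.cast_zero, zero_app, zero_smul]
  | succ m ih => rw [Nat.cast_succ, add_app, ih, add_smul, one_smul, End.one_def, id_app]

theorem not_isUnit_natCast [Nontrivial R] (e : R ≃+* End G) : ¬ IsUnit (p : R) := by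
  rintro ⟨c, hc⟩
  have h : e 1 = 0 := by
    refine hom_ext fun n => ?_
    have h1 : (1 : R) = ((p ^ n : ℕ) : R) * (↑c⁻¹) ^ n := by
      rw [Nat.cast_pow, ← hc, ← mul_pow, Units.mul_inv, one_pow]
    rw [h1, app_mul, app_natCast, G.pow_smul_eq_zero, zero_comp, zero_app]
  exact one_ne_zero (e.injective (h.trans (map_zero e).symm))

theorem dvd_natCast [IsLocalRing R] (e : R ≃+* End G) {ϖ : R}
    (hϖ : IsLocalRing.maximalIdeal R = Ideal.span {ϖ}) : ϖ ∣ (p : R) := by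
  rw [← Ideal.mem_span_singleton, ← hϖ, IsLocalRing.mem_maximalIdeal]
  exact not_isUnit_natCast e

variable (ϖ : R)

theorem torsionIncl_app_pow (n : ℕ) : G.torsionIncl (e ϖ) n ≫ app (e (ϖ ^ n)) n = 0 := by
  rw [map_pow]
  exact torsionIncl_comp G (e ϖ) n

theorem exists_lift_torsionIncl {n : ℕ} (z : Z ⟶ G.level n)
    (hz : z ≫ app (e (ϖ ^ n)) n = 0) : ∃ a, a ≫ G.torsionIncl (e ϖ) n = z := by
  rw [map_pow] at hz
  exact ⟨kernel.lift _ z hz, kernel.lift_ι _ _ _⟩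

theorem torsionSucc_torsionIncl (n : ℕ) : G.torsionSucc (e ϖ) n ≫ G.torsionIncl (e ϖ) (n + 1) =
    G.torsionIncl (e ϖ) n ≫ G.incl n := kernel.lift_ι _ _ _

instance mono_torsionSucc (n : ℕ) : Mono (G.torsionSucc (e ϖ) n) :=
  have : Mono (G.torsionSucc (e ϖ) n ≫ G.torsionIncl (e ϖ) (n + 1)) := by
    rw [torsionSucc_torsionIncl]
    exact mono_comp _ _
  mono_of_mono _ (G.torsionIncl (e ϖ) (n + 1))

theorem torsionSucc_torsionMap (n : ℕ) (r : R) : G.torsionSucc (e ϖ) n ≫ torsionMap e ϖ (n + 1) r =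
    torsionMap e ϖ n r ≫ G.torsionSucc (e ϖ) n := by
  rw [← cancel_mono (G.torsionIncl (e ϖ) (n + 1)), Category.assoc, Category.assoc, torsionMap_incl,
    torsionSucc_torsionIncl, reassoc_of% torsionSucc_torsionIncl, incl_app,
    reassoc_of% torsionMap_incl]

theorem torsionMap_mul (n : ℕ) (r s : R) :
    torsionMap e ϖ n (r * s) = torsionMap e ϖ n r ≫ torsionMap e ϖ n s := by
  rw [← cancel_mono (G.torsionIncl (e ϖ) n), Category.assoc, torsionMap_incl, torsionMap_incl,
    reassoc_of% torsionMap_incl, app_mul]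

theorem torsionMap_pow_self (n : ℕ) : torsionMap e ϖ n (ϖ ^ n) = 0 := by
  rw [← cancel_mono (G.torsionIncl (e ϖ) n), torsionMap_incl, torsionIncl_app_pow, zero_comp]

theorem isZero_torsion_zero : IsZero (G.torsion (e ϖ) 0) :=
  .of_mono (G.torsionIncl (e ϖ) 0) G.isZero_level_zero

variable {ϖ} (hdvd : ϖ ∣ (p : R))
include hdvd

theorem exists_lift_torsionSucc {n : ℕ} (z : Z ⟶ G.torsion (e ϖ) (n + 1))
    (hz : z ≫ torsionMap e ϖ (n + 1) (ϖ ^ n) = 0) : ∃ a, a ≫ G.torsionSucc (e ϖ) n = z := by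
  obtain ⟨c, hc⟩ := pow_dvd_pow_of_dvd hdvd n
  have hϖz : z ≫ G.torsionIncl (e ϖ) (n + 1) ≫ app (e (ϖ ^ n)) (n + 1) = 0 := by
    rw [← torsionMap_incl, reassoc_of% hz, zero_comp]
  have hpz : (p ^ n : ℕ) • (z ≫ G.torsionIncl (e ϖ) (n + 1)) = 0 := by
    rw [← Category.comp_id (z ≫ _), ← Preadditive.comp_nsmul, ← app_natCast e, Nat.cast_pow, hc,
      app_mul, Category.assoc, reassoc_of% hϖz, zero_comp]
  obtain ⟨b, hb⟩ := G.exists_lift_incl _ hpz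
  obtain ⟨a, rfl⟩ := exists_lift_torsionIncl e ϖ b (by
    rw [← cancel_mono (G.incl n), Category.assoc, ← incl_app, reassoc_of% hb, hϖz, zero_comp])
  exact ⟨a, by rw [← cancel_mono (G.torsionIncl (e ϖ) (n + 1)), Category.assoc,
    torsionSucc_torsionIncl, ← Category.assoc, hb]⟩

theorem exists_torsionProj (n : ℕ) :
    ∃ ψ, ψ ≫ G.torsionSucc (e ϖ) n = torsionMap e ϖ (n + 1) ϖ :=
  exists_lift_torsionSucc e hdvd _ (by rw [← torsionMap_mul, ← pow_succ', torsionMap_pow_self])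

/-- Multiplication by `ϖ`, as a map from `G[ϖⁿ⁺¹]` to `G[ϖⁿ]`. -/
noncomputable def torsionProj (n : ℕ) : G.torsion (e ϖ) (n + 1) ⟶ G.torsion (e ϖ) n :=
  (exists_torsionProj e hdvd n).choose

theorem torsionProj_torsionSucc (n : ℕ) :
    torsionProj e hdvd n ≫ G.torsionSucc (e ϖ) n = torsionMap e ϖ (n + 1) ϖ :=
  (exists_torsionProj e hdvd n).choose_spec

theorem torsionSucc_torsionProj (n : ℕ) :
    G.torsionSucc (e ϖ) n ≫ torsionProj e hdvd n = torsionMap e ϖ n ϖ := by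
  rw [← cancel_mono (G.torsionSucc (e ϖ) n), Category.assoc, torsionProj_torsionSucc,
    torsionSucc_torsionMap]

/-- The tower of the `G[ϖⁿ]`, with multiplication by `ϖ` as projections. -/
noncomputable abbrev torsionTower : Tower O where
  obj := G.torsion (e ϖ)
  incl := G.torsionSucc (e ϖ)
  proj := torsionProj e hdvd
  comm _ := (torsionSucc_torsionProj e hdvd _).trans (torsionProj_torsionSucc e hdvd _).symm

/-- An element of `R` acts on the tower of the `G[ϖⁿ]`. -/
noncomputable def torsionEndo (r : R) : (torsionTower e hdvd).Endo where
  app n := torsionMap e ϖ n r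
  incl_app n := torsionSucc_torsionMap e ϖ n r
  app_proj n := by
    rw [← cancel_mono (G.torsionSucc (e ϖ) n), Category.assoc, Category.assoc,
      torsionProj_torsionSucc, ← torsionSucc_torsionMap, reassoc_of% torsionProj_torsionSucc,
      ← torsionMap_mul, ← torsionMap_mul, mul_comm]

theorem toOne_fromOne : ∀ n : ℕ, (torsionTower e hdvd).toOne n ≫ (torsionTower e hdvd).fromOne n =
    torsionMap e ϖ (n + 1) (ϖ ^ n)
  | 0 => by
    rw [pow_zero]
    exact (Category.comp_id _).trans (map_one (torsionAction e ϖ 1)).symm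
  | n + 1 => by
    rw [Tower.toOne_succ, Tower.fromOne_succ, Category.assoc, reassoc_of% toOne_fromOne n,
      ← torsionSucc_torsionMap, reassoc_of% torsionProj_torsionSucc, ← torsionMap_mul, pow_succ']

-- Writing `p = ϖ c`, multiplication by `p` from level `n + 1` to level `n` becomes, over
-- `G[ϖⁿ] ⊆ level n`, the composite of multiplication by `c` into `G[ϖⁿ⁺¹]` with `torsionProj`.
theorem appTop_injective_torsionProj [IsDomain O] {n : ℕ} (h : IsFiniteFlat (G.torsion (e ϖ) n)) :
    Function.Injective (schemeMap (torsionProj e hdvd n)).appTop.hom := by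
  obtain ⟨c, hc⟩ := hdvd
  have sq := IsPullback.of_hasPullback (G.mul n) (G.torsionIncl (e ϖ) n)
  set x := pullback.fst (G.mul n) (G.torsionIncl (e ϖ) n)
  set y := pullback.snd (G.mul n) (G.torsionIncl (e ϖ) n)
  have hmul := G.isShortExact_mul n
  have hP := hmul.isFiniteFlat_of_isPullback (G.isFiniteFlat _) (G.isFiniteFlat _) h sq
  have hy : fpqc (schemeMap y) :=
    (hmul.of_isPullback sq (sq.lift_fst _ 0 (by rw [hmul.comp_eq_zero, zero_comp]))
      (sq.lift_snd _ _ _)).fpqc_schemeMap hP h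
  have hxp : x ≫ app (e (p : R)) (n + 1) = y ≫ G.torsionIncl (e ϖ) n ≫ G.incl n := by
    rw [app_natCast, ← mul_incl, sq.w_assoc]
  obtain ⟨z, hz⟩ := exists_lift_torsionIncl e ϖ (x ≫ app (e c) (n + 1)) (by
    rw [Category.assoc, ← app_mul, pow_succ', ← mul_assoc, mul_comm c, ← hc, app_mul,
      reassoc_of% hxp, incl_app, reassoc_of% torsionIncl_app_pow, zero_comp, comp_zero])
  have hzy : z ≫ torsionProj e ⟨c, hc⟩ n = y := by
    rw [← cancel_mono (G.torsionSucc (e ϖ) n), ← cancel_mono (G.torsionIncl (e ϖ) (n + 1)),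
      Category.assoc, Category.assoc, Category.assoc, reassoc_of% torsionProj_torsionSucc,
      torsionMap_incl, reassoc_of% hz, ← app_mul, mul_comm c, ← hc, hxp, torsionSucc_torsionIncl]
  have hinj := appTop_injective_of_fpqc hy hP h
  rw [← hzy, schemeMap_comp, Scheme.Hom.comp_appTop, CommRingCat.hom_comp, RingHom.coe_comp]
    at hinj
  exact hinj.of_comp

theorem isExact_torsionTower [IsDomain O] (h : ∀ n, IsFiniteFlat (G.torsion (e ϖ) n)) :
    (torsionTower e hdvd).IsExact := by
  have hz : IsZero ((torsionTower e hdvd).obj 0) := isZero_torsion_zero e ϖ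
  have : ∀ n, Mono ((torsionTower e hdvd).incl n) := mono_torsionSucc e ϖ
  obtain ⟨d, hd⟩ := (h 1).exists_hasOrder
  have hproj (n : ℕ) : IsShortExact ((torsionTower e hdvd).fromOne n) (torsionProj e hdvd n) := by
    obtain ⟨hk⟩ := nonempty_isLimit_kernelFork (Tower.fromOne_proj hz n)
      (Tower.exists_lift_fromOne (t := torsionTower e hdvd) fun n _ z hz =>
        exists_lift_torsionSucc e hdvd z (by
          rw [pow_succ', torsionMap_mul, ← torsionProj_torsionSucc e hdvd, Category.assoc,
            reassoc_of% hz, zero_comp]))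
    exact isShortExact_of_appTop_injective hk (h 1) (h (n + 1)) (h n) hd
      (appTop_injective_torsionProj e hdvd (h n))
  refine ⟨hz, hproj, fun n => ?_⟩
  obtain ⟨⟨_, _⟩, _⟩ := Tower.fpqc_toOne (t := torsionTower e hdvd)
    (fun n => (hproj n).fpqc_schemeMap (h _) (h _)) n
  exact ⟨Tower.incl_toOne hz n, nonempty_isLimit_kernelFork _ fun z hz =>
    exists_lift_torsionSucc e hdvd z (by
      rw [← toOne_fromOne e hdvd, reassoc_of% hz, zero_comp]), inferInstance, inferInstance⟩

end Torsion

end PDivisibleGroup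

/-! ### Direct sums of tower terms -/

section Biproduct

variable {C : Type u} [Category.{v} C] [Preadditive C] [HasBinaryBiproducts C]

theorem isIso_biprod_lift_biproduct_lift_π [HasFiniteBiproducts C] {J K : Type} [Finite J]
    [Finite K] (F : J → C) (σ : Option K ≃ J) :
    IsIso (biprod.lift (biproduct.π F (σ none))
      (biproduct.lift fun k => biproduct.π F (σ (some k)))) := by
  classical
  have := Fintype.ofFinite J
  have := Fintype.ofFinite K
  refine ⟨biprod.desc (biproduct.ι F (σ none)) (biproduct.desc fun k => biproduct.ι F (σ (some k))),
    ?_, ?_⟩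
  · rw [biprod.lift_desc, biproduct.lift_desc, ← biproduct.total,
      ← σ.sum_comp, Fintype.sum_option]
  · ext k l
    all_goals simp [biproduct.ι_π]

theorem nonempty_biproduct_option_iso [HasFiniteBiproducts C] {K : Type} [Finite K]
    (F : Option K → C) : Nonempty ((⨁ F) ≅ F none ⊞ ⨁ fun k => F (some k)) :=
  ⟨@asIso _ _ _ _ _ (isIso_biprod_lift_biproduct_lift_π F (Equiv.refl _))⟩

theorem isIso_biprod_lift_sub_comp {A B X : C} (u : X ⟶ A) (v : X ⟶ B) (c : A ⟶ B)
    [IsIso (biprod.lift u v)] : IsIso (biprod.lift u (v - u ≫ c)) := by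
  let shear : A ⊞ B ≅ A ⊞ B :=
    { hom := biprod.lift biprod.fst (biprod.snd - biprod.fst ≫ c)
      inv := biprod.lift biprod.fst (biprod.snd + biprod.fst ≫ c)
      hom_inv_id := by ext <;> simp [Preadditive.comp_add]
      inv_hom_id := by ext <;> simp [Preadditive.comp_sub] }
  have h : biprod.lift u (v - u ≫ c) = biprod.lift u v ≫ shear.hom := by
    apply biprod.hom_ext <;> simp [Preadditive.comp_sub, shear]
  exact h ▸ IsIso.comp_isIso' inferInstance shear.isIso_hom

end Biproduct

namespace CommGroupScheme

attribute [local instance] hasBinaryBiproducts_of_finite_biproducts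

variable {O : Type u} [CommRing O]

theorem IsFiniteFlat.isShortExact_biprod_map {A B D W : CommGroupScheme O} {i : A ⟶ B} {q : B ⟶ D}
    (hW : IsFiniteFlat W) (h : IsShortExact i q) :
    IsShortExact (biprod.map i (𝟙 W)) (biprod.fst ≫ q) := by
  have := h.mono
  have := h.flat
  have := h.surjective
  have := hW.flat
  have := W.surjective_structureMap
  have sq := isPullback_biprod B W
  have : Flat (schemeMap (biprod.fst : B ⊞ W ⟶ B)) :=
    MorphismProperty.of_isPullback sq inferInstance
  have : Surjective (schemeMap (biprod.fst : B ⊞ W ⟶ B)) :=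
    MorphismProperty.of_isPullback sq inferInstance
  have : Mono (biprod.map i (𝟙 W)) := ⟨fun x y hxy => by
    apply biprod.hom_ext
    · rw [← cancel_mono i]
      simpa using hxy =≫ biprod.fst
    · simpa using hxy =≫ biprod.snd⟩
  refine ⟨by simp [h.comp_eq_zero], nonempty_isLimit_kernelFork _ fun z hz => ?_,
    by rw [schemeMap_comp]; infer_instance, by rw [schemeMap_comp]; infer_instance⟩
  obtain ⟨a, ha⟩ := h.exists_lift (z ≫ biprod.fst) (by rwa [Category.assoc])
  exact ⟨biprod.lift a (z ≫ biprod.snd), biprod.hom_ext _ _ (by simp [ha]) (by simp)⟩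

theorem isZero_biproduct_of_isEmpty {J : Type} [IsEmpty J] (F : J → CommGroupScheme O) :
    IsZero (⨁ F) := by
  rw [IsZero.iff_id_eq_zero]
  exact biproduct.hom_ext _ _ isEmptyElim

theorem IsFiniteFlat.biproduct {J : Type} [hJ : Finite J] {F : J → CommGroupScheme O}
    (hF : ∀ s, IsFiniteFlat (F s)) : IsFiniteFlat (⨁ F) := by
  revert hJ F
  refine Finite.induction_empty_option (P := fun J => ∀ [Finite J] {F : J → CommGroupScheme O},
    (∀ s, IsFiniteFlat (F s)) → IsFiniteFlat (⨁ F)) ?equiv ?empty ?option J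
  case equiv =>
    intro J K σ ih _ F hF
    have := Finite.of_equiv K σ.symm
    exact (ih fun s => hF (σ s)).of_iso (biproduct.reindex σ F).symm
  case empty =>
    intro _ F _
    let T : CommGroupScheme O := CommGrp.trivial _
    have hT : IsFiniteFlat T := ⟨inferInstanceAs (IsFinite (𝟙 _)), inferInstanceAs (Flat (𝟙 _))⟩
    have hT₀ : IsZero T := by
      rw [IsZero.iff_id_eq_zero]
      exact CommGrp.hom_ext _ _ (toUnit_unique _ _)
    exact hT.of_iso ((isZero_biproduct_of_isEmpty F).iso hT₀)
  case option =>
    intro K _ ih _ F hF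
    obtain ⟨ψ⟩ := nonempty_biproduct_option_iso F
    exact ((hF none).biprod (ih fun k => hF (some k))).of_iso ψ

variable {I : Type w} {t : I → Tower O} {X : CommGroupScheme O}

/-- `X` is a finite direct sum of terms of positive index of the towers `t i`. -/
def IsSumOfTowers (t : I → Tower O) (X : CommGroupScheme O) : Prop :=
  ∃ (J : Type) (_ : Finite J) (a : J → I) (n : J → ℕ), (∀ s, 1 ≤ n s) ∧
    Nonempty (X ≅ ⨁ fun s => (t (a s)).obj (n s))

namespace IsSumOfTowers

theorem of_isZero (hX : IsZero X) : IsSumOfTowers t X :=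
  ⟨Empty, inferInstance, Empty.elim, Empty.elim, isEmptyElim,
    ⟨hX.iso (isZero_biproduct_of_isEmpty _)⟩⟩

theorem of_iso_biprod {K : Type} [Finite K] {a : K → I} {n : K → ℕ} (hn : ∀ s, 1 ≤ n s) (i : I)
    {m : ℕ} (hm : 1 ≤ m) (θ : X ≅ (t i).obj m ⊞ ⨁ fun s => (t (a s)).obj (n s)) :
    IsSumOfTowers t X := by
  let a' (o : Option K) : I := o.elim i a
  let n' (o : Option K) : ℕ := o.elim m n
  obtain ⟨ψ⟩ := nonempty_biproduct_option_iso fun o => (t (a' o)).obj (n' o)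
  exact ⟨Option K, inferInstance, a', n', Option.rec hm hn, ⟨θ ≪≫ ψ.symm⟩⟩

theorem exists_fin (h : IsSumOfTowers t X) :
    ∃ (r : ℕ) (a : Fin r → I) (n : Fin r → ℕ), (∀ s, 1 ≤ n s) ∧
      Nonempty (X ≅ ⨁ fun s => (t (a s)).obj (n s)) := by
  obtain ⟨J, _, a, n, hn, ⟨θ⟩⟩ := h
  obtain ⟨r, ⟨σ⟩⟩ := Finite.exists_equiv_fin J
  exact ⟨r, a ∘ σ.symm, n ∘ σ.symm, fun s => hn _,
    ⟨θ ≪≫ (biproduct.reindex σ.symm fun s => (t (a s)).obj (n s)).symm⟩⟩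

end IsSumOfTowers

variable {X' D : CommGroupScheme O}

/-- A family of exact towers in `𝒞` whose bottom terms have the smallest possible endomorphism rings
and extension groups: these are the properties of the towers `Gᵢ[πᵢⁿ]` that the decomposition
uses. -/
structure IsOrthogonal (𝒞 : ObjectProperty (CommGroupScheme O)) (t : I → Tower O) : Prop where
  isExact (i : I) : (t i).IsExact
  mem (i : I) (n : ℕ) : 𝒞 ((t i).obj n)
  exists_endo (i : I) (f₀ f : (t i).obj 1 ⟶ (t i).obj 1) : f₀ ≠ 0 →
    ∃ c : (t i).Endo, f₀ ≫ c.app 1 = f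
  exists_extension (i : I) {E : CommGroupScheme O} (κ : (t i).obj 1 ⟶ E) (q : E ⟶ (t i).obj 1) :
    𝒞 E → IsShortExact κ q → ∃ h : E ⟶ (t i).obj 2, κ ≫ h = (t i).incl 1
  exists_retraction {i j : I} : i ≠ j → ∀ {E : CommGroupScheme O} (κ : (t i).obj 1 ⟶ E)
    (q : E ⟶ (t j).obj 1), 𝒞 E → IsShortExact κ q → ∃ d : E ⟶ (t i).obj 1, κ ≫ d = 𝟙 _

/-- The maps `φ`, `f`, `g` form a morphism from the sequence `X' ⟶ X ⟶ D` to the sequence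
`T n ⟶ T (n + 1) ⟶ T 1` of a tower `T`. If both are exact, `g` is the obstruction to factoring `f`
through `T n`, that is, to extending `φ` to `X`. -/
structure Tower.IsExtensionHom (T : Tower O) (inc : X' ⟶ X) (π : X ⟶ D) {n : ℕ}
    (φ : X' ⟶ T.obj n) (f : X ⟶ T.obj (n + 1)) (g : D ⟶ T.obj 1) : Prop where
  inc_comp : inc ≫ f = φ ≫ T.incl n
  comp_eq : π ≫ g = f ≫ T.toOne n

theorem Tower.IsExact.exists_extension {T : Tower O} (hT : T.IsExact) {inc : X' ⟶ X} {π : X ⟶ D}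
    {n : ℕ} {φ : X' ⟶ T.obj n} {f : X ⟶ T.obj (n + 1)} (h : T.IsExtensionHom inc π φ f 0) :
    ∃ f' : X ⟶ T.obj n, inc ≫ f' = φ := by
  have hSE := hT.isShortExact_incl n
  have := hSE.mono
  obtain ⟨f', hf'⟩ := hSE.exists_lift f (by rw [← h.comp_eq, comp_zero])
  exact ⟨f', by rw [← cancel_mono (T.incl n), Category.assoc, hf', h.inc_comp]⟩

namespace IsOrthogonal

variable {𝒞 : ObjectProperty (CommGroupScheme O)} {j : I} {inc : X' ⟶ X} {π : X ⟶ (t j).obj 1}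

section Extend

variable (ht : IsOrthogonal 𝒞 t) (h𝒞 : IsSubquotientClosed 𝒞) (h : IsShortExact inc π)
  (hX' : 𝒞 X') (hX : 𝒞 X)
include ht h𝒞 h hX' hX

theorem exists_extension_of_ne {i : I} (hij : i ≠ j) :
    ∀ {n : ℕ} (φ : X' ⟶ (t i).obj n), ∃ f : X ⟶ (t i).obj n, inc ≫ f = φ
  | 0, φ => ⟨0, (ht.isExact i).isZero.eq_of_tgt _ _⟩
  | n + 1, φ => by
    obtain ⟨g, hg⟩ := exists_extension_of_ne hij (φ ≫ (t i).proj n)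
    refine h𝒞.exists_extension h ((ht.isExact i).isShortExact_proj n) hX' hX (ht.mem _ _)
      (ht.mem _ _) (ht.mem _ _) hg fun κ q hP hSE => ?_
    obtain ⟨d, hd⟩ := ht.exists_retraction hij κ q hP hSE
    exact ⟨d ≫ (t i).fromOne n, by rw [reassoc_of% hd]⟩

theorem exists_extension_succ :
    ∀ {n : ℕ} (φ : X' ⟶ (t j).obj n), ∃ f : X ⟶ (t j).obj (n + 1), inc ≫ f = φ ≫ (t j).incl n
  | 0, φ => ⟨0, by rw [(ht.isExact j).isZero.eq_of_tgt φ 0, comp_zero, zero_comp]⟩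
  | n + 1, φ => by
    obtain ⟨g, hg⟩ := exists_extension_succ (φ ≫ (t j).proj n)
    have hg' : inc ≫ g = (φ ≫ (t j).incl (n + 1)) ≫ (t j).proj (n + 1) := by
      rw [hg, Category.assoc, Category.assoc, (t j).comm]
    refine h𝒞.exists_extension h ((ht.isExact j).isShortExact_proj (n + 1)) hX' hX (ht.mem _ _)
      (ht.mem _ _) (ht.mem _ _) hg' fun κ q hP hSE => ?_
    obtain ⟨d, hd⟩ := ht.exists_extension j κ q hP hSE
    obtain ⟨a, ha⟩ := (t j).exists_incl_comp_eq_fromOne n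
    exact ⟨d ≫ a, by rw [reassoc_of% hd, ha]⟩

theorem exists_isExtensionHom {i : I} {n : ℕ} (φ : X' ⟶ (t i).obj n) :
    ∃ f g, (t i).IsExtensionHom inc π φ f g ∧ (g ≠ 0 → i = j) := by
  have hSE := (ht.isExact i).isShortExact_incl n
  by_cases hij : i = j
  · subst hij
    obtain ⟨f, hf⟩ := ht.exists_extension_succ h𝒞 h hX' hX φ
    obtain ⟨g, hg⟩ := h.exists_desc (h𝒞.isFiniteFlat hX) (h𝒞.isFiniteFlat (ht.mem _ _))
      (f ≫ (t i).toOne n) (by rw [reassoc_of% hf, hSE.comp_eq_zero, comp_zero])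
    exact ⟨f, g, ⟨hf, hg⟩, fun _ => rfl⟩
  · obtain ⟨f, hf⟩ := ht.exists_extension_of_ne h𝒞 h hX' hX hij φ
    refine ⟨f ≫ (t i).incl n, 0, ⟨by rw [reassoc_of% hf], ?_⟩, (absurd rfl ·)⟩
    rw [Category.assoc, hSE.comp_eq_zero, comp_zero, comp_zero]

end Extend

section Correct

variable {n₀ : ℕ} {φ₀ : X' ⟶ (t j).obj n₀} {f₀ : X ⟶ (t j).obj (n₀ + 1)}
  {g₀ : (t j).obj 1 ⟶ (t j).obj 1}

theorem exists_correction (ht : IsOrthogonal 𝒞 t) (h₀ : (t j).IsExtensionHom inc π φ₀ f₀ g₀)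
    [IsIso g₀] {i : I} {n : ℕ} {φ : X' ⟶ (t i).obj n} {f : X ⟶ (t i).obj (n + 1)}
    {g : (t j).obj 1 ⟶ (t i).obj 1} (h : (t i).IsExtensionHom inc π φ f g)
    (hg : g ≠ 0 → i = j ∧ n ≤ n₀) :
    ∃ (c : (t j).obj n₀ ⟶ (t i).obj n) (f' : X ⟶ (t i).obj n), inc ≫ f' = φ - φ₀ ≫ c := by
  obtain rfl | hg0 := eq_or_ne g 0
  · obtain ⟨f', hf'⟩ := (ht.isExact i).exists_extension h
    exact ⟨0, f', by rw [hf', comp_zero, sub_zero]⟩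
  · obtain ⟨rfl, hn⟩ := hg hg0
    have hg₀ : g₀ ≠ 0 := fun h => hg0 ((cancel_epi g₀).1 (by rw [h, zero_comp, zero_comp]))
    obtain ⟨c, hc⟩ := ht.exists_endo i g₀ g hg₀
    obtain ⟨a, b, hab, hb⟩ := (t i).exists_proj hn
    have h' : (t i).IsExtensionHom inc π (φ - φ₀ ≫ a ≫ c.app n) (f - f₀ ≫ b ≫ c.app (n + 1)) 0 := by
      constructor
      · simp only [Preadditive.comp_sub, Preadditive.sub_comp, Category.assoc, h.inc_comp,
          reassoc_of% h₀.inc_comp, reassoc_of% hab, c.incl_app]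
      · rw [Preadditive.sub_comp, Category.assoc, Category.assoc, c.app_toOne, reassoc_of% hb,
          ← reassoc_of% h₀.comp_eq, hc, h.comp_eq, sub_self, comp_zero]
    exact ⟨_, (ht.isExact i).exists_extension h'⟩

theorem isSumOfTowers_of_forall_le (ht : IsOrthogonal 𝒞 t) (h𝒞 : IsSubquotientClosed 𝒞)
    (hSE : IsShortExact inc π) (hX : 𝒞 X) (h₀ : (t j).IsExtensionHom inc π φ₀ f₀ g₀)
    [IsIso g₀] {K : Type} [Finite K] {a : K → I} {n : K → ℕ} (hn : ∀ s, 1 ≤ n s)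
    {φ : ∀ s, X' ⟶ (t (a s)).obj (n s)} {f : ∀ s, X ⟶ (t (a s)).obj (n s + 1)}
    {g : ∀ s, (t j).obj 1 ⟶ (t (a s)).obj 1}
    (h : ∀ s, (t (a s)).IsExtensionHom inc π (φ s) (f s) (g s))
    (hg : ∀ s, g s ≠ 0 → a s = j ∧ n s ≤ n₀)
    [IsIso (biprod.lift φ₀ (biproduct.lift φ))] : IsSumOfTowers t X := by
  choose c f' hf' using fun s => ht.exists_correction h₀ (h s) (hg s)
  have := isIso_biprod_lift_sub_comp φ₀ (biproduct.lift φ) (biproduct.lift c)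
  have hW : IsFiniteFlat (⨁ fun s => (t (a s)).obj (n s)) :=
    .biproduct fun s => h𝒞.isFiniteFlat (ht.mem _ _)
  have hf'_lift : inc ≫ biproduct.lift f' = biproduct.lift φ - φ₀ ≫ biproduct.lift c := by
    apply biproduct.hom_ext
    simp [hf', Preadditive.sub_comp]
  have : IsIso (biprod.lift f₀ (biproduct.lift f')) :=
    hSE.isIso (hW.isShortExact_biprod_map ((ht.isExact j).isShortExact_incl n₀))
      (h𝒞.isFiniteFlat hX) ((h𝒞.isFiniteFlat (ht.mem _ _)).biprod hW)
      (h𝒞.isFiniteFlat (ht.mem j 1)) _ (biprod.lift φ₀ (biproduct.lift φ - φ₀ ≫ biproduct.lift c))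
      g₀ (by apply biprod.hom_ext <;> simp [h₀.inc_comp, hf'_lift]) (by simp [h₀.comp_eq])
  exact .of_iso_biprod hn j (Nat.le_add_left 1 n₀) (asIso (biprod.lift f₀ (biproduct.lift f')))

end Correct

theorem isSumOfTowers_of_isShortExact (ht : IsOrthogonal 𝒞 t) (h𝒞 : IsSubquotientClosed 𝒞)
    (h : IsShortExact inc π) (hX' : 𝒞 X') (hX : 𝒞 X) (hsum : IsSumOfTowers t X') :
    IsSumOfTowers t X := by
  classical
  obtain ⟨J, _, a, n, hn, ⟨θ⟩⟩ := hsum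
  let φ (s : J) : X' ⟶ (t (a s)).obj (n s) := θ.hom ≫ biproduct.π _ s
  choose f g hfg hg using fun s => ht.exists_isExtensionHom h𝒞 h hX' hX (φ s)
  obtain hg0 | ⟨s₁, hs₁⟩ := forall_or_exists_not fun s => g s = 0
  · -- `X'` is regarded as having the extra summand `(t j).obj 0 = 0`, with obstruction `𝟙`.
    have h₀ : (t j).IsExtensionHom inc π (n := 0) 0 π (𝟙 _) :=
      ⟨by rw [h.comp_eq_zero, zero_comp], by rw [Tower.toOne_zero]⟩
    have hφ : biproduct.lift φ = θ.hom := biproduct.hom_ext _ _ (by simp [φ])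
    have : IsIso (biprod.lift (0 : X' ⟶ (t j).obj 0) (biproduct.lift φ)) :=
      ⟨biprod.snd ≫ θ.inv, by simp [hφ], by
        apply biprod.hom_ext
        · exact (ht.isExact j).isZero.eq_of_tgt _ _
        · simp [hφ]⟩
    exact ht.isSumOfTowers_of_forall_le h𝒞 h hX h₀ hn hfg fun s hs => absurd (hg0 s) hs
  · obtain ⟨s₀, hs₀, hmax⟩ := Set.exists_max_image {s | g s ≠ 0} n (Set.toFinite _) ⟨s₁, hs₁⟩
    obtain rfl := hg s₀ hs₀
    have := Tower.isIso_of_ne_zero (ht.exists_endo _) hs₀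
    have := isIso_biprod_lift_biproduct_lift_π (fun s => (t (a s)).obj (n s))
      (Equiv.optionSubtypeNe s₀)
    have hφ : biprod.lift (φ s₀) (biproduct.lift fun s : {s // s ≠ s₀} => φ s) =
        θ.hom ≫ biprod.lift (biproduct.π _ s₀)
          (biproduct.lift fun s : {s // s ≠ s₀} => biproduct.π _ s.1) := by
      apply biprod.hom_ext
      · simp [φ]
      · apply biproduct.hom_ext
        simp [φ]
    have : IsIso (biprod.lift (φ s₀) (biproduct.lift fun s : {s // s ≠ s₀} => φ s)) :=
      hφ ▸ IsIso.comp_isIso' inferInstance this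
    exact ht.isSumOfTowers_of_forall_le (K := {s // s ≠ s₀}) h𝒞 h hX (hfg s₀) (fun s => hn s)
      (fun s => hfg s) fun s hs => ⟨hg s hs, hmax s hs⟩

theorem isSumOfTowers_of_hasFiltration (ht : IsOrthogonal 𝒞 t) (h𝒞 : IsSubquotientClosed 𝒞)
    (hX : 𝒞 X) (hfilt : HasFiltration (fun Q => ∃ i, Nonempty (Q ≅ (t i).obj 1)) X) :
    IsSumOfTowers t X := by
  induction hfilt with
  | zero X hX₀ => exact .of_isZero hX₀
  | step i q _ hi _ h hQ ih =>
    obtain ⟨j, ⟨δ⟩⟩ := hQ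
    have hA := h𝒞.sub i hi hX
    exact ht.isSumOfTowers_of_isShortExact h𝒞 (h.comp_isIso (𝟙 _) δ.hom) hA hX (ih hA)

end IsOrthogonal

end CommGroupScheme

namespace PDivisibleGroup

variable {p : ℕ} {O : Type u} [CommRing O] {G : PDivisibleGroup p O} {R : Type w} [CommRing R]
  {ϖ : R}

theorem exists_torsionMap_eq [IsLocalRing R] (e : R ≃+* End G)
    (hϖ : IsLocalRing.maximalIdeal R = Ideal.span {ϖ}) (hdim : homFinrank e ϖ = 1)
    {f₀ : G.torsion (e ϖ) 1 ⟶ G.torsion (e ϖ) 1} (hf₀ : f₀ ≠ 0)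
    (f : G.torsion (e ϖ) 1 ⟶ G.torsion (e ϖ) 1) : ∃ r, f₀ ≫ torsionMap e ϖ 1 r = f := by
  have : (Ideal.span {ϖ}).IsMaximal := hϖ ▸ inferInstance
  let _ : Field (R ⧸ Ideal.span {ϖ}) := Ideal.Quotient.field _
  let _ : Module (R ⧸ Ideal.span {ϖ}) (G.torsion (e ϖ) 1 ⟶ G.torsion (e ϖ) 1) :=
    Module.compHom _ (residueAction e ϖ)
  have hrank : Module.finrank (R ⧸ Ideal.span {ϖ}) (G.torsion (e ϖ) 1 ⟶ G.torsion (e ϖ) 1) = 1 :=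
    hdim
  obtain ⟨c, hc⟩ := (finrank_eq_one_iff_of_nonzero' f₀ hf₀).1 hrank f
  obtain ⟨r, rfl⟩ := Ideal.Quotient.mk_surjective c
  exact ⟨r, hc⟩

theorem exists_extension_torsionSucc {ϖ : End G} {𝒞 : ObjectProperty (CommGroupScheme O)}
    (E : Extension 𝒞 (G.torsion ϖ 1) (G.torsion ϖ 1)) {f : G.torsion ϖ 1 ⟶ G.torsion ϖ 1}
    (hf : G.IsConnecting ϖ 𝒞 f (Quotient.mk _ E)) :
    ∃ h : E.mid ⟶ G.torsion ϖ 2, E.inc ≫ h = G.torsionSucc ϖ 1 := by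
  obtain ⟨E', h, hE, hinc, -⟩ := hf
  obtain ⟨φ, hφ, -⟩ := Quotient.exact hE
  exact ⟨φ.inv ≫ h, by rw [← hφ, Category.assoc, φ.hom_inv_id_assoc, hinc]⟩

end PDivisibleGroup

open PDivisibleGroup

theorem theorem7p10_general {O : Type u} [CommRing O] [IsDomain O] {p : ℕ}
    {𝒞 : ObjectProperty (CommGroupScheme O)} (h𝒞 : IsSubquotientClosed 𝒞)
    {I : Type v} (G : I → PDivisibleGroup p O)
    (R : I → Type w) [∀ i, CommRing (R i)] [∀ i, IsLocalRing (R i)] (e : ∀ i, R i ≃+* End (G i))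
    (ϖ : ∀ i, R i) (hϖ : ∀ i, IsLocalRing.maximalIdeal (R i) = Ideal.span {ϖ i})
    (htors : ∀ i n, 𝒞 ((G i).torsion (e i (ϖ i)) n)) (hdim : ∀ i, homFinrank (e i) (ϖ i) = 1)
    (hδ : ∀ i (c : ExtIn 𝒞 ((G i).torsion (e i (ϖ i)) 1) ((G i).torsion (e i (ϖ i)) 1)),
      ∃ f, (G i).IsConnecting (e i (ϖ i)) 𝒞 f c)
    (hext : ∀ i j, i ≠ j →
      Subsingleton (ExtIn 𝒞 ((G i).torsion (e i (ϖ i)) 1) ((G j).torsion (e j (ϖ j)) 1)))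
    {X : CommGroupScheme O} (hX : 𝒞 X)
    (hfilt : HasFiltration (fun Q => ∃ i, Nonempty (Q ≅ (G i).torsion (e i (ϖ i)) 1)) X) :
    ∃ (r : ℕ) (a : Fin r → I) (n : Fin r → ℕ), (∀ s, 1 ≤ n s) ∧
      Nonempty (X ≅ ⨁ fun s => (G (a s)).torsion (e (a s) (ϖ (a s))) (n s)) := by
  let t (i : I) : Tower O := torsionTower (e i) (dvd_natCast (e i) (hϖ i))
  have ht : IsOrthogonal 𝒞 t :=
    { isExact := fun i => isExact_torsionTower (e i) _ fun n => h𝒞.isFiniteFlat (htors i n)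
      mem := htors
      exists_endo := fun i _ f hf₀ =>
        have ⟨r, hr⟩ := exists_torsionMap_eq (e i) (hϖ i) (hdim i) hf₀ f
        ⟨torsionEndo (e i) _ r, hr⟩
      exists_extension := fun i _ _ _ hE h =>
        have ⟨_, hf⟩ := hδ i (Quotient.mk _ ⟨_, hE, _, _, h⟩)
        exists_extension_torsionSucc _ hf
      exists_retraction := fun {i j} hij _ _ _ hE h =>
        have := hext j i hij.symm
        h𝒞.exists_retraction (htors j 1) (htors i 1) hE h }
  exact (ht.isSumOfTowers_of_hasFiltration h𝒞 hX hfilt).exists_fin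

theorem theorem7p10 {O : Type u} [CommRing O] [IsDomain O] [IsNoetherianRing O] [CharZero O]
    (p : ℕ) (hp : p.Prime)
    -- the full subcategory `𝒞` of finite flat commutative group schemes of `p`-power order
    (𝒞 : ObjectProperty (CommGroupScheme O))
    (h𝒞 : ∀ X, 𝒞 X → IsFiniteFlat X ∧ ∃ m, HasOrder X (p ^ m))
    (hprod : ∀ X Y, 𝒞 X → 𝒞 Y → 𝒞 (X ⨯ Y))
    (hsub : ∀ (X Y : CommGroupScheme O) (i : X ⟶ Y), IsClosedFlatSubgroup i → 𝒞 Y → 𝒞 X)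
    (hquot : ∀ (X Y Z : CommGroupScheme O) (i : X ⟶ Y) (q : Y ⟶ Z), IsClosedFlatSubgroup i →
      IsFiniteFlat Z → IsShortExact i q → 𝒞 Y → 𝒞 Z)
    -- the `p`-divisible groups `G i`, with `End (G i)` a discrete valuation ring
    {I : Type v} [Finite I] (G : I → PDivisibleGroup p O)
    (R : I → Type w) [∀ i, CommRing (R i)] [∀ i, IsDomain (R i)]
    [∀ i, IsDiscreteValuationRing (R i)] (e : ∀ i, R i ≃+* End (G i))
    (ϖ : ∀ i, R i) (hϖ : ∀ i, Irreducible (ϖ i))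
    (htors : ∀ i n, 𝒞 ((G i).torsion (e i (ϖ i)) n))
    -- `δ` is an isomorphism of one-dimensional vector spaces
    (hdim : ∀ i, PDivisibleGroup.homFinrank (e i) (ϖ i) = 1)
    (hδ : ∀ i (c : ExtIn 𝒞 ((G i).torsion (e i (ϖ i)) 1) ((G i).torsion (e i (ϖ i)) 1)),
      ∃! f, (G i).IsConnecting (e i (ϖ i)) 𝒞 f c)
    -- the extension groups between different indices are trivial
    (hext : ∀ i j, i ≠ j →
      Subsingleton (ExtIn 𝒞 ((G i).torsion (e i (ϖ i)) 1) ((G j).torsion (e j (ϖ j)) 1)))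
    -- a group scheme in `𝒞` filtered by copies of the `G i [ϖ i]`
    (X : CommGroupScheme O) (hX : 𝒞 X)
    (hfilt : HasFiltration (fun Q => ∃ i, Nonempty (Q ≅ (G i).torsion (e i (ϖ i)) 1)) X) :
    ∃ (r : ℕ) (a : Fin r → I) (n : Fin r → ℕ), (∀ s, 1 ≤ n s) ∧
      Nonempty (X ≅ ⨁ fun s => (G (a s)).torsion (e (a s) (ϖ (a s))) (n s)) :=
  theorem7p10_general
    ⟨fun hX => (h𝒞 _ hX).1, hprod _ _, fun i => hsub _ _ i, fun i q => hquot _ _ _ i q⟩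
    G R e ϖ (fun i => (hϖ i).maximalIdeal_eq) htors hdim (fun i c => (hδ i c).exists) hext hX hfilt
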